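/- Let $X=\sum_{i=1}^3 P_i(z_1,z_2,z_3)\,\partial/\partial z_i$ be a vector field on $\mathbb{C}^3$ whose components $P_i$ are quadratic homogeneous polynomials. A \emph{radial orbit} of $X$ is a line $\rho\subset\mathbb{C}^3$ through the origin that is invariant by $X$; it is \emph{nondegenerate} if $X$ vanishes at no point of $\rho\setminus\{0\}$, and $X$ is \emph{nondegenerate} if all its radial orbits are. If $\rho$ is a nondegenerate radial orbit, there is a unique $a\in\rho\setminus\{0\}$ with $P_i(a)=a_i$ for all $i$; with $M=\big(\partial P_i/\partial z_j(a)\big)_{i,j}$, the number $-1$ is an eigenvalue of $\mathbb{I}-M$, and the \emph{exponents} of $\rho$ are the two roots (an unordered pair, counted with multiplicity) of the polynomial $\det\big([\mathbb{I}-M]-\lambda\mathbb{I}\big)/(\lambda+1)$ in $\lambda$. The vector field $X$ is \emph{semicomplete} if for each $p\in\mathbb{C}^3$ there are a domain $\Omega_p\subset\mathbb{C}$ containing $0$ and a solution $\phi\colon\Omega_p\to\mathbb{C}^3$ of $X$ with $\phi(0)=p$ such that the map $\Omega_p\to\mathbb{C}^3\times\mathbb{C}$, $t\mapsto(\phi(t),t)$,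 is proper. Suppose that $X$ is nondegenerate and semicomplete and that two different radial orbits of $X$ both have exponents $(-1,-2)$. Then there exists a third radial orbit of $X$, different from these two, whose exponents are either $(1,2)$ or $(1,1)$. -/

import Mathlib

/-- The holomorphic vector field `X` on the complex vector space `E` is semicomplete (univalent):
through every point `p` there is a solution `φ`, defined on a domain `Ω ⊆ ℂ` containing `0`, with
`φ 0 = p`, such that `t ↦ (φ t, t)` is a proper map from `Ω` to `E × ℂ`. -/
def IsSemicomplete {E : Type*} [NormedAddCommGroup E] [NormedSpace ℂ E] (X : E → E) : Prop :=
  ∀ p : E, ∃ (Ω : Set ℂ) (φ : ℂ → E), IsOpen Ω ∧ IsConnected Ω ∧ (0 : ℂ) ∈ Ω ∧ φ 0 = p ∧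
    (∀ t ∈ Ω, HasDerivAt φ (X (φ t)) t) ∧
    IsProperMap (fun t : Ω => ((φ t, (t : ℂ)) : E × ℂ))

/-- Quadratic homogeneous vector fields `∑ i, P i ∂/∂z i` on `ℂⁿ`. -/
structure QuadraticVectorField (n : ℕ) where
  P : Fin n → MvPolynomial (Fin n) ℂ
  homogeneous : ∀ i, (P i).IsHomogeneous 2

namespace QuadraticVectorField

variable {n : ℕ} (X : QuadraticVectorField n)

/-- The value of the vector field at the point `z`. -/
noncomputable def eval (z : Fin n → ℂ) : Fin n → ℂ := fun i => MvPolynomial.eval z (X.P i)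

/-- A radial orbit: a line through the origin that is invariant by (tangent to) `X`. -/
def IsRadialOrbit (ρ : Submodule ℂ (Fin n → ℂ)) : Prop :=
  Module.finrank ℂ ρ = 1 ∧ ∀ z ∈ ρ, X.eval z ∈ ρ

/-- All radial orbits of `X` are nondegenerate: `X` vanishes on them at the origin only. -/
def IsNondegenerate : Prop :=
  ∀ ρ : Submodule ℂ (Fin n → ℂ), X.IsRadialOrbit ρ → ∀ z ∈ ρ, z ≠ 0 → X.eval z ≠ 0

/-- The Jacobian matrix `M i j = ∂P i/∂z j` at the point `a`. -/
noncomputable def jacobian (a : Fin n → ℂ) : Matrix (Fin n) (Fin n) ℂ :=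
  Matrix.of fun i j => MvPolynomial.eval a (MvPolynomial.pderiv j (X.P i))

/-- The roots, with multiplicity, of the characteristic polynomial of `1 - M` divided by `λ + 1`,
where `M` is the Jacobian matrix at `a`. (The division is exact if `X.eval a = a` and `a ≠ 0`.) -/
noncomputable def exponentsAt (a : Fin n → ℂ) : Multiset ℂ :=
  ((1 - X.jacobian a).charpoly /ₘ (Polynomial.X + Polynomial.C 1)).roots

/-- `ρ` is a nondegenerate radial orbit of `X` and `s` is the multiset of its Kowalevski exponents.
A nondegenerate radial orbit contains exactly one `a ≠ 0` with `X.eval a = a`, and a radial orbit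
that contains such an `a` is nondegenerate. -/
def HasExponents (ρ : Submodule ℂ (Fin n → ℂ)) (s : Multiset ℂ) : Prop :=
  X.IsRadialOrbit ρ ∧ ∃ a ∈ ρ, a ≠ 0 ∧ X.eval a = a ∧ X.exponentsAt a = s

end QuadraticVectorField

/-! Write the field as `z ↦ B z z` with `B` symmetric bilinear. If `φ` is a solution, then `e^{iθ}
φ(1 - e^{iθ})` solves `w' = i (w - B w w)`, and semicompleteness forces every solution of this
equation on `[0, 2π]` to close up. Linearizing at a fixed point `a = B a a`, where the linear part
is the Kowalevski matrix `L = 1 - 2 B a`, gives `exp (2πi L) = 1`. Hence `L` is diagonalizable with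
integer eigenvalues. A second-order version of the argument shows that a zero exponent would make
the radial orbit non-isolated.

Let `e₁`, `e₂` be the fixed points on the two given orbits and `u = 2 B e₁ e₂`. Diagonalizability
gives `(L + 1) (L + 2) = 0` at each of them, which determines `B e₁ u` and `B e₂ u`. Moreover `u`,
`e₁`, `e₂` is a basis, for otherwise a fixed point with exponent `1/2` would exist. The field then
depends only on the three coordinates `p, q, r` of `B u u`.

In the chart `[x : y : 1]`, the remaining radial orbits are the common zeros of two cubics whose
coordinate algebra has dimension 5. None is degenerate, since the exponents do not vanish, so there
are at most 5. A residue computation in this algebra (`sum_chartZeros`) shows that the sums of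
inverse exponents `1/s + 1/t` add up to 7. As `7 > 5 · 4/3`, some orbit has `1/s + 1/t > 4/3`, and
for nonzero integers this leaves only `(1, 1)` and `(1, 2)`. -/

section Analytic

open Set Filter Topology Metric
open scoped NNReal Real

/-! ### Periodicity of the Euler-corrected flow. -/

section

variable {E : Type*} [NormedAddCommGroup E] [NormedSpace ℂ E]

/-- Two solutions on `[a, b]` of an autonomous equation with `C¹` right-hand side that agree at a
point `x < b` agree on the right of `x`. -/
theorem eventuallyEq_nhdsGT_of_hasDerivWithinAt {F : Type*} [NormedAddCommGroup F]
    [NormedSpace ℝ F] {V : F → F} (hV : ContDiff ℝ 1 V) {f g : ℝ → F} {x b : ℝ} (hxb : x < b)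
    (hf : ∀ t ∈ Icc x b, HasDerivWithinAt f (V (f t)) (Icc x b) t)
    (hg : ∀ t ∈ Icc x b, HasDerivWithinAt g (V (g t)) (Icc x b) t) (hfg : f x = g x) :
    ∀ᶠ t in 𝓝[>] x, f t = g t := by
  obtain ⟨K, s, hs, hl⟩ := (hV.contDiffAt (x := f x)).exists_lipschitzOnWith
  have hxm : x ∈ Icc x b := left_mem_Icc.2 hxb.le
  have cont : ∀ {h : ℝ → F}, (∀ t ∈ Icc x b, HasDerivWithinAt h (V (h t)) (Icc x b) t) →
      h x = f x → ∀ᶠ t in 𝓝[≥] x, h t ∈ s := by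
    intro h hh hx
    have h1 : Tendsto h (𝓝[Icc x b] x) (𝓝 (h x)) := (hh x hxm).continuousWithinAt
    rw [nhdsWithin_Icc_eq_nhdsGE hxb, hx] at h1
    exact h1 hs
  obtain ⟨c, hc, hcs⟩ := (mem_nhdsGE_iff_exists_Icc_subset).1
    (((cont hf rfl).and (cont hg hfg.symm)).and (Icc_mem_nhdsGE hxb))
  have hsub : Icc x c ⊆ Icc x b := fun t ht => (hcs ht).2
  have hder : ∀ {h : ℝ → F}, (∀ t ∈ Icc x b, HasDerivWithinAt h (V (h t)) (Icc x b) t) →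
      ∀ t ∈ Ico x c, HasDerivWithinAt h (V (h t)) (Ici t) t := by
    intro h hh t ht
    have := (hh t (hsub (Ico_subset_Icc_self ht))).mono hsub
    exact this.mono_of_mem_nhdsWithin (Icc_mem_nhdsGE_of_mem ht)
  have heq : EqOn f g (Icc x c) :=
    ODE_solution_unique_of_mem_Icc_right (v := fun _ => V) (s := fun _ => s) (K := K)
      (fun _ _ => hl)
      (fun t ht => ((hf t (hsub ht)).continuousWithinAt).mono hsub) (hder hf)
      (fun t ht => (hcs (Ico_subset_Icc_self ht)).1.1)
      (fun t ht => ((hg t (hsub ht)).continuousWithinAt).mono hsub) (hder hg)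
      (fun t ht => (hcs (Ico_subset_Icc_self ht)).1.2) hfg
  filter_upwards [Ioc_mem_nhdsGT hc] with t ht using heq (Ioc_subset_Icc_self ht)

theorem contDiff_euler_sub_quadratic (B : E →L[ℂ] E →L[ℂ] E) :
    ContDiff ℝ 1 (fun z => Complex.I • (z - B z z)) := by
  have h : ContDiff ℂ 1 (fun z => Complex.I • (z - B z z)) := by fun_prop
  exact h.restrict_scalars ℝ

/-- If the quadratic field `z ↦ B z z` is semicomplete, then all the solutions of
`w' = i (w - B w w)` defined on `[0, 2π]` are `2π`-periodic. -/
theorem IsSemicomplete.eq_of_hasDerivWithinAt {B : E →L[ℂ] E →L[ℂ] E}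
    (hB : IsSemicomplete fun z => B z z) {w : ℝ → E}
    (hw : ∀ θ ∈ Icc 0 (2 * π),
      HasDerivWithinAt w (Complex.I • (w θ - B (w θ) (w θ))) (Icc 0 (2 * π)) θ) :
    w (2 * π) = w 0 := by
  obtain ⟨Ω, φ, hΩ, -, h0, hφ0, hφ, hprop⟩ := hB (w 0)
  -- The time `t = 1 - e θ` runs once around the unit circle centred at `1`, from `0` back to `0`.
  set e : ℝ → ℂ := fun θ => Complex.exp (θ * Complex.I) with he
  have hde : ∀ θ, HasDerivAt e (Complex.I * e θ) θ := by
    intro θ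
    have h1 : HasDerivAt (fun θ : ℝ => (θ : ℂ) * Complex.I) (1 * Complex.I) θ :=
      (Complex.ofRealCLM.hasDerivAt (x := θ)).mul_const _
    simpa [he, mul_comm] using h1.cexp
  have hce : Continuous e := by fun_prop
  have hne : ∀ θ, e θ ≠ 0 := fun θ => Complex.exp_ne_zero _
  -- A proper map has closed range, so membership of the candidate point of the graph is a closed
  -- condition on `θ`: the loop cannot leave `Ω` while `w` stays finite.
  set S : Set ℝ := {θ | ((e θ)⁻¹ • w θ, 1 - e θ) ∈ range fun t : Ω => ((φ t, (t : ℂ)) : E × ℂ)}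
    with hS
  have hSmem : ∀ θ, θ ∈ S ↔ 1 - e θ ∈ Ω ∧ e θ • φ (1 - e θ) = w θ := by
    intro θ
    constructor
    · rintro ⟨t, ht⟩
      simp only [Prod.mk.injEq] at ht
      rw [← ht.2]
      exact ⟨t.2, by rw [ht.1, smul_inv_smul₀ (hne θ)]⟩
    · rintro ⟨h1, h2⟩
      exact ⟨⟨_, h1⟩, by simp [← h2, inv_smul_smul₀ (hne θ)]⟩
  have hcw : ContinuousOn w (Icc 0 (2 * π)) := fun θ hθ => (hw θ hθ).continuousWithinAt
  have hclosed : IsClosed (S ∩ Icc 0 (2 * π)) := by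
    have hc : ContinuousOn (fun θ => ((e θ)⁻¹ • w θ, 1 - e θ)) (Icc 0 (2 * π)) :=
      ((hce.inv₀ hne).continuousOn.smul hcw).prodMk (by fun_prop)
    have := hc.preimage_isClosed_of_isClosed isClosed_Icc hprop.isClosedMap.isClosed_range
    rwa [inter_comm] at this
  have hsub : Icc 0 (2 * π) ⊆ S := by
    refine hclosed.Icc_subset_of_forall_mem_nhdsWithin ?_ ?_
    · rw [hSmem]; simp [he, h0, hφ0]
    · rintro θ ⟨hθS, hθ⟩
      obtain ⟨h1, h2⟩ := (hSmem θ).1 hθS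
      have hopen : ∀ᶠ s in 𝓝[≥] θ, 1 - e s ∈ Ω :=
        nhdsWithin_le_nhds ((continuous_const.sub hce).continuousAt.preimage_mem_nhds
          (hΩ.mem_nhds h1))
      obtain ⟨c, hc, hcs⟩ := (mem_nhdsGE_iff_exists_Icc_subset).1
        (hopen.and (Icc_mem_nhdsGE hθ.2))
      have hsubc : Icc θ c ⊆ Icc 0 (2 * π) := fun s hs =>
        ⟨hθ.1.trans (hcs hs).2.1, (hcs hs).2.2⟩
      -- Both `e • φ (1 - e)` and `w` solve the Euler-corrected equation, so uniqueness propagates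
      -- their equality to the right of `θ`.
      have key := eventuallyEq_nhdsGT_of_hasDerivWithinAt (contDiff_euler_sub_quadratic B) hc
        (f := fun s => e s • φ (1 - e s)) (g := w) ?_ (fun s hs => (hw s (hsubc hs)).mono hsubc) h2
      · filter_upwards [key, Ioc_mem_nhdsGT hc] with s hs hs'
        exact (hSmem s).2 ⟨(hcs (Ioc_subset_Icc_self hs')).1, hs⟩
      · intro s hs
        have hφs := hφ _ (hcs hs).1
        have h3 : HasDerivAt (fun s => 1 - e s) (-(Complex.I * e s)) s := by
          simpa using (hde s).const_sub 1
        have h4 := hφs.scomp s h3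
        have h5 := ((hde s).smul h4).hasDerivWithinAt (s := Icc θ c)
        refine h5.congr_deriv ?_
        simp only [Function.comp, map_smul, smul_apply]
        module
  have := (hSmem _).1 (hsub (right_mem_Icc.2 (by positivity)))
  rw [← this.2]
  simp [he, hφ0, Complex.exp_two_pi_mul_I]

end

/-! ### Linear flow and solutions near the origin. -/

section

/-- A version of the Picard-Lindelöf theorem that records that the solution stays in the ball. -/
theorem IsPicardLindelof.exists_hasDerivWithinAt_mem_closedBall {F : Type*}
    [NormedAddCommGroup F] [NormedSpace ℝ F] [CompleteSpace F] {f : ℝ → F → F} {tmin tmax : ℝ}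
    {t₀ : Icc tmin tmax} {x₀ x : F} {a r L K : ℝ≥0} (hf : IsPicardLindelof f t₀ x₀ a r L K)
    (hx : x ∈ closedBall x₀ r) :
    ∃ α : ℝ → F, α t₀ = x ∧ (∀ t, α t ∈ closedBall x₀ a) ∧
      ∀ t ∈ Icc tmin tmax, HasDerivWithinAt α (f t (α t)) (Icc tmin tmax) t := by
  obtain ⟨α, hα⟩ := ODE.FunSpace.exists_isFixedPt_next hf hx
  refine ⟨α.compProj, by rw [ODE.FunSpace.compProj_val, ← hα, ODE.FunSpace.next_apply₀],
    fun t => α.compProj_mem_closedBall hf.mul_max_le, fun t ht ↦ ?_⟩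
  apply ODE.hasDerivWithinAt_picard_Icc t₀.2 hf.continuousOn_uncurry
    α.continuous_compProj.continuousOn (fun _ ht' ↦ α.compProj_mem_closedBall hf.mul_max_le)
    x ht |>.congr_of_mem _ ht
  intro t' ht'
  nth_rw 1 [← hα]
  rw [ODE.FunSpace.compProj_of_mem ht', ODE.FunSpace.next_apply]

theorem HasDerivWithinAt.clm_apply_complex {E F : Type*} [NormedAddCommGroup E] [NormedSpace ℂ E]
    [NormedAddCommGroup F] [NormedSpace ℂ F] {T : ℝ → E →L[ℂ] F} {T' : E →L[ℂ] F} {c : ℝ → E}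
    {c' : E} {s : Set ℝ} {θ : ℝ} (hT : HasDerivWithinAt T T' s θ) (hc : HasDerivWithinAt c c' s θ) :
    HasDerivWithinAt (fun θ => T θ (c θ)) (T θ c' + T' (c θ)) s θ := by
  have h := ((isBoundedBilinearMap_apply (𝕜 := ℂ) (E := E) (F := F)).hasFDerivAt
    (T θ, c θ)).restrictScalars ℝ
  simpa using! h.comp_hasDerivWithinAt θ (hT.prodMk hc)

theorem HasDerivWithinAt.clm_comp_complex {E F : Type*} [NormedAddCommGroup E] [NormedSpace ℂ E]
    [NormedAddCommGroup F] [NormedSpace ℂ F] (T : E →L[ℂ] F) {c : ℝ → E}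
    {c' : E} {s : Set ℝ} {θ : ℝ} (hc : HasDerivWithinAt c c' s θ) :
    HasDerivWithinAt (fun θ => T (c θ)) (T c') s θ := by
  simpa using (hasDerivWithinAt_const θ s T).clm_apply_complex hc

variable {E : Type*} [NormedAddCommGroup E] [NormedSpace ℂ E]

/-- The one-parameter group `θ ↦ exp (i θ L)`. -/
noncomputable def rotExp (L : E →L[ℂ] E) (θ : ℝ) : E →L[ℂ] E :=
  NormedSpace.exp (((θ : ℂ) * Complex.I) • L)

theorem rotExp_zero (L : E →L[ℂ] E) : rotExp L 0 = 1 := by simp [rotExp]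

variable [CompleteSpace E]

theorem hasDerivAt_rotExp (L : E →L[ℂ] E) (θ : ℝ) :
    HasDerivAt (rotExp L) (Complex.I • (L * rotExp L θ)) θ := by
  have h1 : HasDerivAt (fun θ : ℝ => (θ : ℂ) * Complex.I) (1 * Complex.I) θ :=
    (Complex.ofRealCLM.hasDerivAt (x := θ)).mul_const _
  have h2 := (hasDerivAt_exp_smul_const' L ((θ : ℂ) * Complex.I)).scomp θ h1
  simpa [rotExp] using! h2

theorem rotExp_mul_rotExp_neg (L : E →L[ℂ] E) (θ : ℝ) : rotExp L θ * rotExp L (-θ) = 1 := by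
  let _ := NormedAlgebra.restrictScalars ℚ ℂ (E →L[ℂ] E)
  rw [rotExp, rotExp, ← NormedSpace.exp_add_of_commute]
  · rw [← add_smul]; simp
  · exact ((Commute.refl L).smul_left _).smul_right _

theorem rotExp_apply_rotExp_neg (L : E →L[ℂ] E) (θ : ℝ) (v : E) :
    rotExp L θ (rotExp L (-θ) v) = v := by
  rw [← mul_apply_eq_comp, rotExp_mul_rotExp_neg, one_apply_eq_self]

theorem continuous_rotExp (L : E →L[ℂ] E) : Continuous (rotExp L) :=
  continuous_iff_continuousAt.2 fun θ => (hasDerivAt_rotExp L θ).continuousAt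

/-- On a Jordan block of size at most two, `exp (i θ L)` is given by the usual formula. -/
theorem rotExp_apply_of_sub_eq (L : E →L[ℂ] E) {μ : ℂ} {v n : E} (hv : L v = μ • v + n)
    (hn : L n = μ • n) (θ : ℝ) :
    rotExp L θ v = Complex.exp (θ * Complex.I * μ) • (v + ((θ : ℂ) * Complex.I) • n) := by
  have hcomm : ∀ θ w, L (rotExp L θ w) = rotExp L θ (L w) := by
    intro θ w
    have : Commute L (rotExp L θ) := by
      let _ := NormedAlgebra.restrictScalars ℚ ℂ (E →L[ℂ] E)
      exact ((Commute.refl L).smul_right _).exp_right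
    simpa using! congrArg (fun T : E →L[ℂ] E => T w) this.eq
  have key : ∀ {v n : E}, L v = μ • v + n → L n = μ • n →
      rotExp L θ v = Complex.exp (θ * Complex.I * μ) • v +
        ((θ : ℂ) * Complex.I) • rotExp L θ n := by
    intro v n hv hn
    -- Undoing the expected solution should give a constant; this is proved with `rotExp L θ n` left
    -- unevaluated, and `key` is then applied a second time to `n` itself.
    set g : ℝ → E := fun θ => Complex.exp (-(θ * Complex.I * μ)) • (rotExp L θ v -
      ((θ : ℂ) * Complex.I) • rotExp L θ n) with hgdef
    have hg : ∀ θ, HasDerivAt g 0 θ := by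
      intro θ
      have h1 : HasDerivAt (fun θ : ℝ => (θ : ℂ) * Complex.I) (1 * Complex.I) θ :=
        (Complex.ofRealCLM.hasDerivAt (x := θ)).mul_const _
      have hap : ∀ w, HasDerivAt (fun θ => rotExp L θ w) (Complex.I • (rotExp L θ (L w))) θ := by
        intro w
        have := (hasDerivAt_rotExp L θ).hasDerivWithinAt (s := univ) |>.clm_apply_complex
          (hasDerivWithinAt_const θ univ w)
        simpa [hcomm, hasDerivWithinAt_univ] using! this
      have h2 := (h1.mul_const μ).neg.cexp.smul ((hap v).sub (h1.smul (hap n)))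
      refine h2.congr_deriv ?_
      simp only [hv, hn, map_add, map_smul, Pi.sub_apply, Pi.smul_apply', Pi.neg_apply]
      module
    have hconst : g θ = g 0 := is_const_of_deriv_eq_zero (fun θ => (hg θ).differentiableAt)
      (fun θ => (hg θ).deriv) θ 0
    have h0 : g 0 = v := by simp [hgdef, rotExp_zero]
    rw [h0] at hconst
    have h1 : Complex.exp (θ * Complex.I * μ) • g θ = Complex.exp (θ * Complex.I * μ) • v := by
      rw [hconst]
    rw [hgdef, smul_smul, ← Complex.exp_add, add_neg_cancel, Complex.exp_zero, one_smul] at h1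
    rw [← h1, sub_add_cancel]
  rw [key hv hn, key (v := n) (n := 0) (by simp [hn]) (by simp), map_zero, smul_zero, add_zero,
    smul_add, smul_comm]

theorem exists_norm_rotExp_le (L : E →L[ℂ] E) :
    ∃ K : ℝ, 1 ≤ K ∧ ∀ θ ∈ Icc (-(2 * π)) (2 * π), ‖rotExp L θ‖ ≤ K := by
  obtain ⟨K, hK⟩ := isCompact_Icc.exists_bound_of_continuousOn
    (continuous_rotExp L).continuousOn (s := Icc (-(2 * π)) (2 * π))
  exact ⟨max 1 K, le_max_left _ _, fun θ hθ => (hK θ hθ).trans (le_max_right _ _)⟩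

/-- Solutions of `d' = i (L d - B d d)` that start near the origin exist on `[0, 2π]`, stay near the
origin, and are approximated by those of the linear equation. -/
theorem exists_solution_near_zero (L : E →L[ℂ] E) (B : E →L[ℂ] E →L[ℂ] E) :
    ∃ C r₀ : ℝ, 0 < C ∧ 0 < r₀ ∧ ∀ r : ℝ, 0 < r → r ≤ r₀ → ∀ d₀ : E, ‖d₀‖ ≤ r →
      ∃ d : ℝ → E, d 0 = d₀ ∧ (∀ θ ∈ Icc 0 (2 * π),
        HasDerivWithinAt d (Complex.I • (L (d θ) - B (d θ) (d θ))) (Icc 0 (2 * π)) θ) ∧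
        (∀ θ ∈ Icc 0 (2 * π), ‖d θ‖ ≤ C * r) ∧
        ‖d (2 * π) - rotExp L (2 * π) d₀‖ ≤ C * r ^ 2 := by
  obtain ⟨K, hK1, hK⟩ := exists_norm_rotExp_le L
  have hKpos : 0 < K := by linarith
  set H : ℝ := K ^ 3 * (‖B‖ + 1) with hH
  have hHpos : 0 < H := by positivity
  -- Variation of constants: with `d θ = rotExp L θ (c θ)`, the equation for `c` has no linear term.
  set f : ℝ → E → E := fun θ c =>
    -(Complex.I • rotExp L (-θ) (B (rotExp L θ c) (rotExp L θ c))) with hf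
  have hmem : ∀ θ ∈ Icc 0 (2 * π), ‖rotExp L θ‖ ≤ K ∧ ‖rotExp L (-θ)‖ ≤ K := fun θ hθ =>
    ⟨hK θ ⟨by linarith [hθ.1, hθ.2], hθ.2⟩, hK _ ⟨by linarith [hθ.2], by linarith [hθ.1, hθ.2]⟩⟩
  have hbil : ∀ θ ∈ Icc 0 (2 * π), ∀ c c' : E,
      ‖rotExp L (-θ) (B (rotExp L θ c) (rotExp L θ c'))‖ ≤ H * ‖c‖ * ‖c'‖ := by
    intro θ hθ c c'
    obtain ⟨h1, h2⟩ := hmem θ hθ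
    calc ‖rotExp L (-θ) (B (rotExp L θ c) (rotExp L θ c'))‖
        ≤ ‖rotExp L (-θ)‖ * (‖B‖ * ‖rotExp L θ c‖ * ‖rotExp L θ c'‖) :=
          (ContinuousLinearMap.le_opNorm _ _).trans (by gcongr; exact B.le_opNorm₂ _ _)
      _ ≤ K * ((‖B‖ + 1) * (K * ‖c‖) * (K * ‖c'‖)) := by
          gcongr
          · linarith
          · exact (ContinuousLinearMap.le_opNorm _ _).trans (by gcongr)
          · exact (ContinuousLinearMap.le_opNorm _ _).trans (by gcongr)
      _ = H * ‖c‖ * ‖c'‖ := by rw [hH]; ring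
  -- The speed of `c` is at most `4 H r²` where `‖c‖ ≤ 2 r`; over time `2π` this is at most `r` when
  -- `8πHr ≤ 1`, so `c` stays in the ball. Applying `rotExp`, of norm at most `K`, gives the bounds
  -- `2 K r` on `d` and `8πHK r²` on the error.
  refine ⟨2 * K + 8 * π * H * K, 1 / (8 * π * H), by positivity, by positivity, ?_⟩
  intro r hr hr0 d₀ hd₀
  have hr1 : 8 * π * H * r ≤ 1 := by
    rw [le_div_iff₀ (by positivity)] at hr0; linarith
  have hball : ∀ c ∈ closedBall d₀ r, ‖c‖ ≤ 2 * r := by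
    intro c hc
    have := norm_le_norm_add_norm_sub' c d₀
    rw [mem_closedBall_iff_norm] at hc
    linarith
  have hpic : IsPicardLindelof f (tmin := 0) (tmax := 2 * π)
      ⟨0, left_mem_Icc.2 (by positivity)⟩ d₀ (⟨r, hr.le⟩ : ℝ≥0) 0
      (⟨4 * H * r ^ 2, by positivity⟩ : ℝ≥0) (⟨4 * H * r, by positivity⟩ : ℝ≥0) := by
    refine ⟨fun θ hθ => ?_, fun c hc => ?_, fun θ hθ c hc => ?_, ?_⟩
    · refine LipschitzOnWith.of_dist_le_mul fun c hc c' hc' => ?_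
      have h1 := hball c hc
      have h2 := hball c' hc'
      rw [dist_eq_norm, dist_eq_norm]
      have : f θ c - f θ c' = -(Complex.I •
          (rotExp L (-θ) (B (rotExp L θ c) (rotExp L θ (c - c'))) +
            rotExp L (-θ) (B (rotExp L θ (c - c')) (rotExp L θ c')))) := by
        simp only [hf, map_sub, sub_apply]
        module
      rw [this, norm_neg, norm_smul, Complex.norm_I, one_mul]
      calc _ ≤ H * ‖c‖ * ‖c - c'‖ + H * ‖c - c'‖ * ‖c'‖ :=
            (norm_add_le _ _).trans (add_le_add (hbil θ hθ _ _) (hbil θ hθ _ _))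
        _ ≤ H * (2 * r) * ‖c - c'‖ + H * ‖c - c'‖ * (2 * r) := by gcongr
        _ = 4 * H * r * ‖c - c'‖ := by ring
    · have := continuous_rotExp L
      exact Continuous.continuousOn (by simp only [hf]; fun_prop)
    · have h1 := hball c hc
      simp only [hf, norm_neg, norm_smul, Complex.norm_I, one_mul]
      calc _ ≤ H * ‖c‖ * ‖c‖ := hbil θ hθ _ _
        _ ≤ H * (2 * r) * (2 * r) := by gcongr
        _ = 4 * H * r ^ 2 := by ring
    · have : max (2 * π - 0) (0 - 0) = 2 * π := by
        rw [sub_zero, sub_zero, max_eq_left (by positivity)]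
      change 4 * H * r ^ 2 * max (2 * π - 0) (0 - 0) ≤ r - 0
      rw [this]
      nlinarith
  obtain ⟨c, hc0, hcball, hcder⟩ :=
    hpic.exists_hasDerivWithinAt_mem_closedBall (mem_closedBall_self (by simp))
  simp only at hc0 hcball
  have hcn : ∀ θ, ‖c θ‖ ≤ 2 * r := fun θ => hball _ (hcball θ)
  refine ⟨fun θ => rotExp L θ (c θ), by simp [rotExp_zero, hc0], fun θ hθ => ?_, fun θ hθ => ?_, ?_⟩
  · have h1 := (hasDerivAt_rotExp L θ).hasDerivWithinAt.clm_apply_complex (hcder θ hθ)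
    refine h1.congr_deriv ?_
    simp only [hf, map_neg, map_smul, rotExp_apply_rotExp_neg, smul_apply, mul_apply_eq_comp]
    module
  · calc ‖rotExp L θ (c θ)‖ ≤ K * (2 * r) :=
          (ContinuousLinearMap.le_opNorm _ _).trans
            (mul_le_mul (hmem θ hθ).1 (hcn θ) (norm_nonneg _) hKpos.le)
      _ ≤ (2 * K + 8 * π * H * K) * r := by nlinarith [show 0 ≤ 8 * π * H * K * r by positivity]
  · have h2 := norm_image_sub_le_of_norm_deriv_le_segment' hcder
      (C := 4 * H * r ^ 2) (fun θ hθ => hpic.norm_le θ (Ico_subset_Icc_self hθ) _ (hcball θ))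
      (2 * π) (right_mem_Icc.2 (by positivity))
    rw [hc0, sub_zero] at h2
    rw [← map_sub]
    calc _ ≤ K * (4 * H * r ^ 2 * (2 * π)) :=
          (ContinuousLinearMap.le_opNorm _ _).trans
            (mul_le_mul (hmem _ (right_mem_Icc.2 (by positivity))).1 h2 (norm_nonneg _) hKpos.le)
      _ ≤ (2 * K + 8 * π * H * K) * r ^ 2 := by nlinarith [show 0 ≤ 2 * K * r ^ 2 by positivity]

end

/-! ### Kowalevski matrices of semicomplete fields. -/

section

variable {E : Type*} [NormedAddCommGroup E] [NormedSpace ℂ E] {B : E →L[ℂ] E →L[ℂ] E} {a : E}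

/-- The Kowalevski matrix `1 - M` of the quadratic field `z ↦ B z z` at the point `a`. -/
noncomputable def kowalevski (B : E →L[ℂ] E →L[ℂ] E) (a : E) : E →L[ℂ] E :=
  ContinuousLinearMap.id ℂ E - (2 : ℂ) • B a

theorem kowalevski_apply (B : E →L[ℂ] E →L[ℂ] E) (a v : E) :
    kowalevski B a v = v - (2 : ℂ) • B a v := by simp [kowalevski]

theorem kowalevski_apply_sub (hsymm : ∀ v w, B v w = B w v) (ha : B a a = a) (d : E) :
    kowalevski B a d - B d d = (a + d) - B (a + d) (a + d) := by
  simp only [kowalevski_apply, map_add, add_apply, ha, hsymm d a]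
  module

theorem IsSemicomplete.eq_of_hasDerivWithinAt_kowalevski
    (hB : IsSemicomplete fun z => B z z) (hsymm : ∀ v w, B v w = B w v) (ha : B a a = a) {d : ℝ → E}
    (hd : ∀ θ ∈ Icc 0 (2 * π), HasDerivWithinAt d
      (Complex.I • (kowalevski B a (d θ) - B (d θ) (d θ))) (Icc 0 (2 * π)) θ) :
    d (2 * π) = d 0 := by
  have := hB.eq_of_hasDerivWithinAt (w := fun θ => a + d θ) fun θ hθ => by
    rw [← kowalevski_apply_sub hsymm ha]
    exact (hd θ hθ).const_add a
  simpa using this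

variable [CompleteSpace E]

/-- The linearized monodromy around a nondegenerate radial orbit of a semicomplete quadratic field
is trivial. -/
theorem IsSemicomplete.rotExp_kowalevski (hB : IsSemicomplete fun z => B z z)
    (hsymm : ∀ v w, B v w = B w v) (ha : B a a = a) : rotExp (kowalevski B a) (2 * π) = 1 := by
  obtain ⟨C, r₀, hC, hr₀, h⟩ := exists_solution_near_zero (kowalevski B a) B
  ext v
  rw [one_apply_eq_self]
  by_contra hne
  set N := ‖v - rotExp (kowalevski B a) (2 * π) v‖ with hN
  have hNpos : 0 < N := norm_pos_iff.2 (sub_ne_zero.2 (Ne.symm hne))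
  -- Periodicity yields `t N ≤ C t² (‖v‖ + 1)²`; the second bound on `t` makes the right-hand side
  -- at most `t N / 2`.
  set t : ℝ := min (r₀ / (‖v‖ + 1)) (N / (2 * C * (‖v‖ + 1) ^ 2)) with ht
  have htpos : 0 < t := by positivity
  obtain ⟨d, hd0, hd, -, hd2⟩ := h (t * (‖v‖ + 1)) (by positivity)
    ((le_div_iff₀ (by positivity)).1 (min_le_left _ _)) ((t : ℂ) • v)
    (by rw [norm_smul, Complex.norm_real, Real.norm_of_nonneg htpos.le]; gcongr; linarith)
  rw [hB.eq_of_hasDerivWithinAt_kowalevski hsymm ha hd, hd0, map_smul, ← smul_sub, norm_smul,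
    Complex.norm_real, Real.norm_of_nonneg htpos.le, ← hN] at hd2
  have h1 : t * (2 * C * (‖v‖ + 1) ^ 2) ≤ N :=
    (le_div_iff₀ (by positivity)).1 (min_le_right _ _)
  have h2 : N ≤ C * t * (‖v‖ + 1) ^ 2 := by
    have : t * N ≤ t * (C * t * (‖v‖ + 1) ^ 2) := hd2.trans_eq (by ring)
    exact le_of_mul_le_mul_left this htpos
  linarith

theorem IsSemicomplete.exists_int_of_kowalevski_eq_smul (hB : IsSemicomplete fun z => B z z)
    (hsymm : ∀ v w, B v w = B w v) (ha : B a a = a) {μ : ℂ} {v : E} (hv : v ≠ 0)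
    (h : kowalevski B a v = μ • v) : ∃ n : ℤ, μ = n := by
  have h1 := rotExp_apply_of_sub_eq (kowalevski B a) (n := 0) (by simpa using h) (by simp) (2 * π)
  rw [hB.rotExp_kowalevski hsymm ha, one_apply_eq_self, smul_zero, add_zero] at h1
  have h2 : Complex.exp (((2 * π : ℝ) : ℂ) * Complex.I * μ) = 1 := by
    have : (Complex.exp (((2 * π : ℝ) : ℂ) * Complex.I * μ) - 1) • v = 0 := by
      rw [sub_smul, one_smul, ← h1, sub_self]
    exact sub_eq_zero.1 ((smul_eq_zero.1 this).resolve_right hv)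
  obtain ⟨n, hn⟩ := Complex.exp_eq_one_iff.1 h2
  refine ⟨n, mul_left_cancel₀ Complex.two_pi_I_ne_zero ?_⟩
  rw [mul_comm _ (n : ℂ), ← hn]
  push_cast
  ring

/-- A Jordan block would contribute the extra term `2πi n` to `exp (2πi L) v`, while the exponential
factor is `1` because `μ` is an integer. -/
theorem IsSemicomplete.eq_zero_of_kowalevski_eq_smul_add (hB : IsSemicomplete fun z => B z z)
    (hsymm : ∀ v w, B v w = B w v) (ha : B a a = a) {μ : ℂ} {v n : E}
    (hv : kowalevski B a v = μ • v + n) (hn : kowalevski B a n = μ • n) : n = 0 := by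
  by_contra hne
  obtain ⟨m, rfl⟩ := hB.exists_int_of_kowalevski_eq_smul hsymm ha hne hn
  have h1 := rotExp_apply_of_sub_eq (kowalevski B a) hv hn (2 * π)
  have h2 : Complex.exp (((2 * π : ℝ) : ℂ) * Complex.I * m) = 1 :=
    Complex.exp_eq_one_iff.2 ⟨m, by push_cast; ring⟩
  rw [hB.rotExp_kowalevski hsymm ha, one_apply_eq_self, h2, one_smul, left_eq_add] at h1
  have h3 : (((2 * π : ℝ) : ℂ) * Complex.I) ≠ 0 := by simp [Real.pi_ne_zero]
  exact hne ((smul_eq_zero.1 h1).resolve_left h3)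

/-- Near a nondegenerate radial orbit of a semicomplete quadratic field, the points at which the
Euler-corrected field lies in the kernel of its linear part are zeros of the former. -/
theorem IsSemicomplete.exists_kowalevski_eq_of_mem_ker (hB : IsSemicomplete fun z => B z z)
    (hsymm : ∀ v w, B v w = B w v) (ha : B a a = a) :
    ∃ r > 0, ∀ d₀ : E, ‖d₀‖ ≤ r → kowalevski B a (kowalevski B a d₀ - B d₀ d₀) = 0 →
      kowalevski B a d₀ = B d₀ d₀ := by
  obtain ⟨C, r₀, hC, hr₀, h⟩ := exists_solution_near_zero (kowalevski B a) B
  set L := kowalevski B a with hL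
  set K : ℝ := ‖L‖ + 2 * ‖B‖ + 1 with hK
  have hKpos : 0 < K := by positivity
  set Γ : ℝ := (Real.exp (K * (2 * π)) - 1) / K with hΓ
  have hΓ0 : 0 ≤ Γ := div_nonneg (sub_nonneg.2 (Real.one_le_exp (by positivity))) hKpos.le
  set D : ℝ := 2 * ‖B‖ * C * Γ with hD
  have hD0 : 0 ≤ D := by positivity
  refine ⟨min r₀ (min (1 / C) (1 / (2 * (D + 1)))), by positivity, fun d₀ hd₀ hker => ?_⟩
  set r := min r₀ (min (1 / C) (1 / (2 * (D + 1)))) with hr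
  have hrpos : 0 < r := by positivity
  have hr1 : C * r ≤ 1 := by
    have : r ≤ 1 / C := (min_le_right _ _).trans (min_le_left _ _)
    rw [le_div_iff₀ hC] at this; linarith
  have hr2 : D * r ≤ 1 / 2 := by
    have : r ≤ 1 / (2 * (D + 1)) := (min_le_right _ _).trans (min_le_right _ _)
    rw [le_div_iff₀ (by positivity)] at this; nlinarith
  obtain ⟨d, hd0, hd, hdn, -⟩ := h r hrpos (min_le_left _ _) d₀ hd₀
  have hper := hB.eq_of_hasDerivWithinAt_kowalevski hsymm ha hd
  -- The velocity `y` (up to `i`) satisfies `y' = i (L y - 2 B d y)`. As `L η = 0` and `d` is small,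
  -- Gronwall keeps `y` within `D r ‖η‖ ≤ ‖η‖ / 2` of its initial value `η`.
  set η := L d₀ - B d₀ d₀ with hη
  set y : ℝ → E := fun θ => L (d θ) - B (d θ) (d θ) with hy
  have hyder : ∀ θ ∈ Icc 0 (2 * π), HasDerivWithinAt (fun θ => y θ - η)
      (Complex.I • (L (y θ - η) - (2 : ℂ) • B (d θ) (y θ - η) - (2 : ℂ) • B (d θ) η))
      (Icc 0 (2 * π)) θ := by
    intro θ hθ
    have h1 := (hd θ hθ)
    have h2 := ((h1.clm_comp_complex L).sub
      ((h1.clm_comp_complex B).clm_apply_complex h1)).sub_const η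
    refine h2.congr_deriv ?_
    rw [map_sub L (y θ) η, hker]
    simp only [map_smul, smul_apply, map_sub, sub_apply, hy, hsymm (L (d θ)) (d θ),
      hsymm ((B (d θ)) (d θ)) (d θ)]
    module
  have hybound : ∀ θ ∈ Icc 0 (2 * π), ‖y θ - η‖ ≤ D * r * ‖η‖ := by
    intro θ hθ
    have hg := norm_le_gronwallBound_of_norm_deriv_right_le (f := fun θ => y θ - η) (δ := 0)
      (K := K) (ε := 2 * ‖B‖ * (C * r) * ‖η‖) (a := 0) (b := 2 * π)
      (fun θ hθ => (hyder θ hθ).continuousWithinAt)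
      (fun θ hθ => (hyder θ (Ico_subset_Icc_self hθ)).mono_of_mem_nhdsWithin
        (Icc_mem_nhdsGE_of_mem hθ)) (by simp [hy, hη, hd0]) ?_ θ hθ
    · refine hg.trans ?_
      rw [gronwallBound_of_K_ne_0 hKpos.ne']
      simp only [zero_mul, zero_add, sub_zero]
      have : Real.exp (K * θ) ≤ Real.exp (K * (2 * π)) := by
        have := hθ.2
        gcongr
      calc _ ≤ 2 * ‖B‖ * (C * r) * ‖η‖ / K * (Real.exp (K * (2 * π)) - 1) := by gcongr
        _ = D * r * ‖η‖ := by rw [hD, hΓ]; ring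
    · intro θ hθ
      have hdθ := hdn θ (Ico_subset_Icc_self hθ)
      rw [norm_smul, Complex.norm_I, one_mul]
      have e1 : ‖L (y θ - η)‖ ≤ ‖L‖ * ‖y θ - η‖ := L.le_opNorm _
      have e2 : ‖(2 : ℂ) • B (d θ) (y θ - η)‖ ≤ 2 * ‖B‖ * ‖y θ - η‖ := by
        rw [norm_smul, Complex.norm_two]
        have := B.le_opNorm₂ (d θ) (y θ - η)
        have h3 : ‖B‖ * ‖d θ‖ * ‖y θ - η‖ ≤ ‖B‖ * 1 * ‖y θ - η‖ := by gcongr; linarith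
        linarith
      have e3 : ‖(2 : ℂ) • B (d θ) η‖ ≤ 2 * ‖B‖ * (C * r) * ‖η‖ := by
        rw [norm_smul, Complex.norm_two]
        have := B.le_opNorm₂ (d θ) η
        have h3 : ‖B‖ * ‖d θ‖ * ‖η‖ ≤ ‖B‖ * (C * r) * ‖η‖ := by gcongr
        linarith
      calc _ ≤ ‖L (y θ - η)‖ + ‖(2 : ℂ) • B (d θ) (y θ - η)‖ + ‖(2 : ℂ) • B (d θ) η‖ :=
            (norm_sub_le _ _).trans (add_le_add_left (norm_sub_le _ _) _)
        _ ≤ K * ‖y θ - η‖ + 2 * ‖B‖ * (C * r) * ‖η‖ := by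
            rw [hK]; nlinarith [norm_nonneg (y θ - η)]
  have hlin : ∀ θ ∈ Icc 0 (2 * π), HasDerivWithinAt
      (fun θ : ℝ => d θ - ((θ : ℂ) * Complex.I) • η) (Complex.I • (y θ - η))
      (Icc 0 (2 * π)) θ := by
    intro θ hθ
    have h1 : HasDerivAt (fun θ : ℝ => (θ : ℂ) * Complex.I) (1 * Complex.I) θ :=
      (Complex.ofRealCLM.hasDerivAt (x := θ)).mul_const _
    have h2 := (hd θ hθ).sub (h1.smul_const η).hasDerivWithinAt
    refine h2.congr_deriv ?_
    simp only [hy]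
    module
  -- Since `d` is periodic, `d - iθη` changes by exactly `-2πi η`, whereas its derivative has norm
  -- at most `‖η‖ / 2`: this forces `η = 0`.
  have hmv := norm_image_sub_le_of_norm_deriv_le_segment' hlin (C := D * r * ‖η‖)
    (fun θ hθ => by
      rw [norm_smul, Complex.norm_I, one_mul]
      exact hybound θ (Ico_subset_Icc_self hθ)) (2 * π) (right_mem_Icc.2 (by positivity))
  rw [hper] at hmv
  have hsimp : d 0 - (((2 * π : ℝ) : ℂ) * Complex.I) • η - (d 0 - (((0 : ℝ) : ℂ) * Complex.I) • η)
      = -((((2 * π : ℝ) : ℂ) * Complex.I) • η) := by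
    simp
  rw [hsimp, norm_neg, norm_smul, norm_mul, Complex.norm_I, Complex.norm_real,
    Real.norm_of_nonneg (by positivity), mul_one, sub_zero] at hmv
  have hη0 : ‖η‖ = 0 := by
    have hpi := Real.pi_pos
    have h5 : D * r * ‖η‖ ≤ 1 / 2 * ‖η‖ := by gcongr
    have h6 : ‖η‖ ≤ D * r * ‖η‖ := by
      have : ‖η‖ * (2 * π) ≤ D * r * ‖η‖ * (2 * π) := by linarith
      exact le_of_mul_le_mul_right this (by positivity)
    linarith [norm_nonneg η]
  exact sub_eq_zero.1 (norm_eq_zero.1 hη0)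

/-- If `0` is an exponent of a nondegenerate radial orbit of a semicomplete quadratic field, then
this radial orbit is not isolated. -/
theorem IsSemicomplete.exists_fixedPoint_near [FiniteDimensional ℂ E]
    (hB : IsSemicomplete fun z => B z z)
    (hsymm : ∀ v w, B v w = B w v) (ha : B a a = a) {k : E} (hk : k ≠ 0)
    (hker : kowalevski B a k = 0) {s : Set E} (hs : s ∈ 𝓝 a) :
    ∃ b ∈ s, b ≠ a ∧ B b b = b := by
  obtain ⟨r, hr, h⟩ := hB.exists_kowalevski_eq_of_mem_ker hsymm ha
  set L := kowalevski B a with hL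
  have hdisj : Disjoint (LinearMap.ker L.toLinearMap) (LinearMap.range L.toLinearMap) := by
    rw [Submodule.disjoint_def]
    rintro _ hx ⟨v, rfl⟩
    exact hB.eq_zero_of_kowalevski_eq_smul_add hsymm ha (μ := 0) (v := v) (by simp [hL])
      (by simpa using! hx)
  have hcompl : IsCompl (LinearMap.ker L.toLinearMap) (LinearMap.range L.toLinearMap) := by
    refine Submodule.isCompl_iff_disjoint _ _ ?_ |>.2 hdisj
    rw [add_comm, LinearMap.finrank_range_add_finrank_ker]
  set π₀ : E →L[ℂ] E := LinearMap.toContinuousLinearMap (Submodule.projection _ _ hcompl) with hπ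
  have hπker : ∀ v, L (π₀ v) = 0 := fun v => (Submodule.projection_apply_mem hcompl v)
  have hπL : ∀ v, π₀ (L v) = 0 := fun v =>
    (Submodule.projection_apply_eq_zero_iff hcompl).2 ⟨v, rfl⟩
  have hπid : ∀ v, L v = 0 → π₀ v = v := fun v hv =>
    (Submodule.projection_eq_self_iff hcompl _).2 hv
  -- Lyapunov–Schmidt reduction: `g` has invertible derivative `L + π₀` at `0`, and `L (g d) = L (L
  -- d - B d d)`. Solving `g d = t k` with small `t ≠ 0` therefore puts `L d - B d d` in the kernel,
  -- where the previous lemma applies.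
  set g : E → E := fun d => L d + π₀ d - (B d d - π₀ (B d d)) with hg
  have hgd : HasStrictFDerivAt g (L + π₀) 0 := by
    have hid := hasStrictFDerivAt_id (𝕜 := ℂ) (0 : E)
    have hq := (B.hasStrictFDerivAt (x := (0 : E))).clm_apply hid
    have := (L.hasStrictFDerivAt.add π₀.hasStrictFDerivAt).sub
      (hq.sub (π₀.hasStrictFDerivAt.comp (0 : E) hq))
    convert! this using 1
    ext v
    simp
  have hinj : Function.Injective (L + π₀) := by
    rw [injective_iff_map_eq_zero]
    intro v hv
    rw [add_apply] at hv
    have h1 : π₀ v = 0 := by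
      have := congrArg π₀ hv
      rwa [map_add, hπL, zero_add, hπid _ (hπker v), map_zero] at this
    rw [h1, add_zero] at hv
    rw [← hπid v hv, h1]
  have hsurj : LinearMap.range (L + π₀ : E →L[ℂ] E).toLinearMap = ⊤ :=
    LinearMap.range_eq_top.2 (LinearMap.injective_iff_surjective.1 hinj)
  have hmap := hgd.map_nhds_eq_of_surj hsurj
  have hg0 : g 0 = 0 := by simp [hg]
  rw [hg0] at hmap
  have hS : closedBall (0 : E) r ∩ (fun d => a + d) ⁻¹' s ∈ 𝓝 (0 : E) :=
    inter_mem (closedBall_mem_nhds _ hr)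
      ((continuous_const.add continuous_id).continuousAt.preimage_mem_nhds (by simpa using hs))
  have himg := image_mem_map (m := g) hS
  rw [hmap] at himg
  have htend : Tendsto (fun t : ℂ => t • k) (𝓝[≠] 0) (𝓝 0) := by
    have : Tendsto (fun t : ℂ => t • k) (𝓝 0) (𝓝 ((0 : ℂ) • k)) :=
      (continuous_id.smul continuous_const).tendsto 0
    rw [zero_smul] at this
    exact this.mono_left nhdsWithin_le_nhds
  obtain ⟨t, ⟨d, ⟨hdr, hds⟩, hdt⟩, ht⟩ := ((htend.eventually himg).and self_mem_nhdsWithin).exists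
  have hd0 : d ≠ 0 := by
    rintro rfl
    rw [hg0] at hdt
    exact (smul_ne_zero ht hk) hdt.symm
  have hLd : L (L d - B d d) = 0 := by
    have := congrArg L hdt
    simp only [hg, map_add, map_sub, hπker, map_smul, hker, smul_zero] at this
    simpa using this
  have hfix := h d (by simpa using hdr) hLd
  refine ⟨a + d, hds, by simpa using hd0, ?_⟩
  have h2 := kowalevski_apply_sub hsymm ha d
  rw [← hL, hfix, sub_self] at h2
  exact (sub_eq_zero.1 h2.symm).symm

end

end Analytic

/-! ### The five-dimensional coordinate algebra of the chart and its residues. -/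

section Chart

/-- In the chart `(x, y) ↦ [x : y : 1]`, the foliation induced by the normal form of the quadratic
field is given by the vector field with components `chartField p r x y` and `chartField q r y x`. -/
def chartField (p r x y : ℂ) : ℂ := p - r * x - 6 * y - 4 * x ^ 2 - 5 * x * y - x ^ 2 * y

/-- The zeros of the vector field in the chart. -/
def chartZeros (p q r : ℂ) : Set (ℂ × ℂ) :=
  {z | chartField p r z.1 z.2 = 0 ∧ chartField q r z.2 z.1 = 0}

/-- The trace of the linear part of the vector field in the chart. -/
def chartTrace (r x y : ℂ) : ℂ := -4 * x * y - 13 * (x + y) - 2 * r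

/-- The determinant of the linear part of the vector field in the chart. -/
def chartDet (r x y : ℂ) : ℂ :=
  (2 * x * (y + 4) + 5 * y + r) * (2 * y * (x + 4) + 5 * x + r) -
    (x ^ 2 + 5 * x + 6) * (y ^ 2 + 5 * y + 6)

/-- The eigenvalue of the quadratic field at the radial direction `[x : y : 1]`. -/
def chartScale (r x y : ℂ) : ℂ := x * y + 5 * (x + y) + r

/-- The value at `(x, y)` of the polynomial with coordinates `h` in `1, x, y, xy, x²`. -/
def chartEval (x y : ℂ) : (Fin 5 → ℂ) →ₗ[ℂ] ℂ where
  toFun h := h 0 + h 1 * x + h 2 * y + h 3 * (x * y) + h 4 * x ^ 2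
  map_add' h k := by simp only [Pi.add_apply]; ring
  map_smul' c h := by simp only [Pi.smul_apply, smul_eq_mul, RingHom.id_apply]; ring

/-- Multiplication by `x` in the coordinate algebra of `chartZeros p q r`, in the basis
`1, x, y, xy, x²`. -/
noncomputable def chartMulX (p q r : ℂ) : (Fin 5 → ℂ) →ₗ[ℂ] (Fin 5 → ℂ) where
  toFun h := ![p * h 3 + (3 * q - 2 * p) * h 4,
    h 0 - r * h 3 + (2 * r - 18 + (5 * q - p) / 2) * h 4,
    -6 * h 3 + (12 - 2 * p - 3 * r) * h 4,
    h 2 - 5 * h 3 - (2 + (p + r) / 2) * h 4,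
    h 1 - 4 * h 3 + ((q + r) / 2 - 7) * h 4]
  map_add' h k := by ext i; fin_cases i <;> simp <;> ring
  map_smul' c h := by ext i; fin_cases i <;> simp <;> ring

/-- Multiplication by `y` in the coordinate algebra of `chartZeros p q r`, in the basis
`1, x, y, xy, x²`. -/
noncomputable def chartMulY (p q r : ℂ) : (Fin 5 → ℂ) →ₗ[ℂ] (Fin 5 → ℂ) where
  toFun h := ![(p - q) / 2 * h 2 + (3 * q - 2 * p) * h 3 + p * h 4,
    -((q + r - 6) / 2) * h 2 + (2 * q + 2 * r - 18) * h 3 - r * h 4,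
    h 0 + (p + r - 6) / 2 * h 2 + (12 - 2 * p - 3 * r) * h 3 - 6 * h 4,
    h 1 - 5 * h 3 - 5 * h 4,
    h 2 - 4 * h 3 - 4 * h 4]
  map_add' h k := by ext i; fin_cases i <;> simp <;> ring
  map_smul' c h := by ext i; fin_cases i <;> simp <;> ring

/-- The Bezoutian of the vector field in the chart, with one of its two arguments at `(x, y)`. -/
def chartBez (p q r x y : ℂ) : Fin 5 → ℂ :=
  ![-2 * x ^ 2 + (r - 4) * (x * y) + (q + 5 * r - 30) * x + (4 * r - 24) * y + 3 * p + 5 * q +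
      r ^ 2 - 36,
    4 * (x * y) + 14 * x + 16 * y + q + 5 * r - 30,
    4 * (x * y) + 16 * x + 14 * y + 4 * r - 24,
    x * y + 4 * x + 4 * y + r - 4,
    -2]

variable {p q r x y : ℂ}

theorem chartEval_apply (x y : ℂ) (h : Fin 5 → ℂ) :
    chartEval x y h = h 0 + h 1 * x + h 2 * y + h 3 * (x * y) + h 4 * x ^ 2 := rfl

/-- The coefficients of `chartMulX` are the reductions of `x²y` and `x³` modulo the two cubics; the
certificate displays the cofactors. -/
theorem chartEval_chartMulX (hx : chartField p r x y = 0) (hy : chartField q r y x = 0)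
    (h : Fin 5 → ℂ) : chartEval x y (chartMulX p q r h) = x * chartEval x y h := by
  unfold chartField at hx hy
  simp [chartEval_apply, chartMulX]
  linear_combination (h 3 - h 4 * (2 * (y + 1) + x * (y + 1) / 2)) * hx +
    h 4 * (1 + 2 * (x + 1) + x * (x + 1) / 2) * hy

theorem chartEval_chartMulY (hx : chartField p r x y = 0) (hy : chartField q r y x = 0)
    (h : Fin 5 → ℂ) : chartEval x y (chartMulY p q r h) = y * chartEval x y h := by
  unfold chartField at hx hy
  simp [chartEval_apply, chartMulY]
  linear_combination (h 4 + h 2 * (y + 1) / 2 - 2 * h 3 * (y + 1)) * hx +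
    (-h 2 * (x + 1) / 2 + h 3 * (1 + 2 * (x + 1))) * hy

theorem chartMulX_chartBez (hx : chartField p r x y = 0) (hy : chartField q r y x = 0) :
    chartMulX p q r (chartBez p q r x y) = x • chartBez p q r x y := by
  unfold chartField at hx hy
  ext i
  fin_cases i <;> simp [chartMulX, chartBez]
  · linear_combination (x * y + x + 4 * y + r) * hx - (x ^ 2 + 5 * x + 6) * hy
  · linear_combination 4 * hx
  · linear_combination 4 * hx
  · linear_combination hx
  · ring

theorem chartMulY_chartBez (hx : chartField p r x y = 0) (hy : chartField q r y x = 0) :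
    chartMulY p q r (chartBez p q r x y) = y • chartBez p q r x y := by
  unfold chartField at hx hy
  ext i
  fin_cases i <;> simp [chartMulY, chartBez]
  · linear_combination (-4 * y - 6) * hx + (4 * x + r) * hy
  · linear_combination 4 * hy
  · linear_combination (-y - 1) * hx + (x + 5) * hy
  · linear_combination hy
  · ring

theorem chartEval_chartBez_self (hx : chartField p r x y = 0) (hy : chartField q r y x = 0) :
    chartEval x y (chartBez p q r x y) = chartDet r x y := by
  unfold chartField at hx hy
  simp [chartEval_apply, chartBez, chartDet]
  linear_combination 3 * hx + (2 * x + 5) * hy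

/-- The Bezoutian at `z` is a joint eigenvector with eigenvalues the coordinates of `z`, while
evaluation at `w` turns the multiplications into the coordinates of `w`. A nonzero value would
identify the two points. -/
theorem chartEval_chartBez_of_ne {z w : ℂ × ℂ} (hz : z ∈ chartZeros p q r)
    (hw : w ∈ chartZeros p q r) (hne : z ≠ w) :
    chartEval w.1 w.2 (chartBez p q r z.1 z.2) = 0 := by
  by_contra h
  have h1 := chartEval_chartMulX hw.1 hw.2 (chartBez p q r z.1 z.2)
  have h2 := chartEval_chartMulY hw.1 hw.2 (chartBez p q r z.1 z.2)
  rw [chartMulX_chartBez hz.1 hz.2, map_smul, smul_eq_mul] at h1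
  rw [chartMulY_chartBez hz.1 hz.2, map_smul, smul_eq_mul] at h2
  exact hne (Prod.ext (mul_right_cancel₀ h h1) (mul_right_cancel₀ h h2))

theorem chartMulX_chartMulY (h : Fin 5 → ℂ) :
    chartMulX p q r (chartMulY p q r h) = chartMulY p q r (chartMulX p q r h) := by
  ext i
  fin_cases i <;> simp [chartMulX, chartMulY] <;> ring

/-- Together with commutativity and the swapped identity, this makes `ℂ⁵` a module over the quotient
of `ℂ[x, y]` by the two cubics, so joint eigenvalues are zeros in the chart. -/
theorem chartMul_chartField (h : Fin 5 → ℂ) :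
    p • h - r • chartMulX p q r h - (6 : ℂ) • chartMulY p q r h
      - (4 : ℂ) • chartMulX p q r (chartMulX p q r h)
      - (5 : ℂ) • chartMulX p q r (chartMulY p q r h)
      - chartMulX p q r (chartMulX p q r (chartMulY p q r h)) = 0 := by
  ext i
  simp only [Pi.sub_apply, Pi.smul_apply, Pi.zero_apply]
  fin_cases i <;> simp [chartMulX, chartMulY] <;> ring

theorem chartMul_chartField_swap (h : Fin 5 → ℂ) :
    q • h - r • chartMulY p q r h - (6 : ℂ) • chartMulX p q r h
      - (4 : ℂ) • chartMulY p q r (chartMulY p q r h)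
      - (5 : ℂ) • chartMulY p q r (chartMulX p q r h)
      - chartMulY p q r (chartMulY p q r (chartMulX p q r h)) = 0 := by
  ext i
  simp only [Pi.sub_apply, Pi.smul_apply, Pi.zero_apply]
  fin_cases i <;> simp [chartMulX, chartMulY] <;> ring

/-- A joint eigenvector of the two multiplications vanishes if its last coordinate does. -/
theorem eq_zero_of_chartMul_eq_smul {h : Fin 5 → ℂ} (hX : chartMulX p q r h = x • h)
    (hY : chartMulY p q r h = y • h) (h4 : h 4 = 0) : h = 0 := by
  have X1 := congrFun hX 1
  have X2 := congrFun hX 2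
  have X4 := congrFun hX 4
  have X3 := congrFun hX 3
  have Y4 := congrFun hY 4
  simp [chartMulX, h4] at X1 X2 X3 X4
  simp [chartMulY, h4] at Y4
  have h2 : h 2 = 4 * h 3 := by linear_combination Y4
  have h1 : h 1 = 4 * h 3 := by linear_combination X4
  have h3 : h 3 = 0 := by
    rw [h2] at X2 X3
    linear_combination -1 / 2 * X2 + 2 * X3
  have h0 : h 0 = 0 := by
    rw [h1, h3] at X1
    linear_combination X1
  ext i
  fin_cases i <;> simp [h0, h1, h2, h3, h4]

theorem mem_chartZeros_of_chartMul_eq_smul {h : Fin 5 → ℂ} (hX : chartMulX p q r h = x • h)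
    (hY : chartMulY p q r h = y • h) (hne : h ≠ 0) : (x, y) ∈ chartZeros p q r := by
  have h1 := chartMul_chartField (p := p) (q := q) (r := r) h
  have h2 := chartMul_chartField_swap (p := p) (q := q) (r := r) h
  simp only [hX, hY, map_smul] at h1 h2
  constructor
  · have : chartField p r x y • h = 0 := by
      rw [← h1, chartField]; module
    exact (smul_eq_zero.1 this).resolve_right hne
  · have : chartField q r y x • h = 0 := by
      rw [← h2, chartField]; module
    exact (smul_eq_zero.1 this).resolve_right hne

/-- Evaluation at a zero is a joint eigenvector of the transposed multiplications, so both
coordinates lie in finite spectra. -/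
theorem chartZeros_finite (p q r : ℂ) : (chartZeros p q r).Finite := by
  have key : ∀ {x y : ℂ}, chartEval x y ≠ 0 := fun {x y} h => by
    have := congrArg (fun f => f ![1, 0, 0, 0, 0]) h
    simp [chartEval_apply] at this
  refine ((Module.End.finite_hasEigenvalue (chartMulX p q r).dualMap).prod
    (Module.End.finite_hasEigenvalue (chartMulY p q r).dualMap)).subset fun z hz => ⟨?_, ?_⟩
  · refine Module.End.hasEigenvalue_of_hasEigenvector (x := chartEval z.1 z.2) ⟨?_, key⟩
    rw [Module.End.mem_eigenspace_iff]
    refine LinearMap.ext fun h => ?_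
    exact chartEval_chartMulX hz.1 hz.2 h
  · refine Module.End.hasEigenvalue_of_hasEigenvector (x := chartEval z.1 z.2) ⟨?_, key⟩
    rw [Module.End.mem_eigenspace_iff]
    refine LinearMap.ext fun h => ?_
    exact chartEval_chartMulY hz.1 hz.2 h

/-- Two commuting endomorphisms that preserve a nonzero subspace have a joint eigenvector in it. -/
theorem exists_joint_eigenvector {V : Type*} [AddCommGroup V] [Module ℂ V] [FiniteDimensional ℂ V]
    {f g : Module.End ℂ V} (hfg : ∀ v, f (g v) = g (f v)) {W : Submodule ℂ V} (hW : W ≠ ⊥)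
    (hf : ∀ v ∈ W, f v ∈ W) (hg : ∀ v ∈ W, g v ∈ W) :
    ∃ v ∈ W, v ≠ 0 ∧ ∃ a b : ℂ, f v = a • v ∧ g v = b • v := by
  have single : ∀ {f : Module.End ℂ V} {W : Submodule ℂ V}, W ≠ ⊥ → (∀ v ∈ W, f v ∈ W) →
      ∃ a : ℂ, ∃ v ∈ W, v ≠ 0 ∧ f v = a • v := by
    intro f W hW hf
    have : Nontrivial W := Submodule.nontrivial_iff_ne_bot.2 hW
    obtain ⟨a, ha⟩ := Module.End.exists_eigenvalue (f.restrict hf)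
    obtain ⟨v, hv⟩ := ha.exists_hasEigenvector
    refine ⟨a, v, v.2, fun h => hv.2 (Subtype.ext h), ?_⟩
    simpa using congrArg Subtype.val hv.apply_eq_smul
  obtain ⟨a, v, hvW, hv0, hv⟩ := single hW hf
  obtain ⟨b, w, hw, hw0, hwb⟩ := single (f := g) (W := W ⊓ f.eigenspace a)
    (fun h => hv0 ((Submodule.eq_bot_iff _).1 h v ⟨hvW, Module.End.mem_eigenspace_iff.2 hv⟩))
    (fun u hu => ⟨hg u hu.1, Module.End.mem_eigenspace_iff.2
      (by rw [hfg, Module.End.mem_eigenspace_iff.1 hu.2, map_smul])⟩)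
  exact ⟨w, hw.1, hw0, a, b, Module.End.mem_eigenspace_iff.1 hw.2, hwb⟩

/-- If the zeros in the chart are nondegenerate, then they separate the elements of the coordinate
algebra. -/
theorem eq_zero_of_chartEval_eq_zero (hJ : ∀ z ∈ chartZeros p q r, chartDet r z.1 z.2 ≠ 0)
    {h : Fin 5 → ℂ} (hh : ∀ z ∈ chartZeros p q r, chartEval z.1 z.2 h = 0) : h = 0 := by
  set W : Submodule ℂ (Fin 5 → ℂ) :=
    ⨅ z ∈ chartZeros p q r, LinearMap.ker (chartEval z.1 z.2) with hW
  have hmem : ∀ k, k ∈ W ↔ ∀ z ∈ chartZeros p q r, chartEval z.1 z.2 k = 0 := by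
    intro k; simp [hW, Submodule.mem_iInf]
  by_contra hne
  obtain ⟨k, hkW, hk0, x, y, hX, hY⟩ := exists_joint_eigenvector (f := chartMulX p q r)
    (g := chartMulY p q r) (W := W) chartMulX_chartMulY
    (fun hbot => hne ((Submodule.eq_bot_iff _).1 hbot h ((hmem h).2 hh)))
    (fun v hv => (hmem _).2 fun z hz => by
      rw [chartEval_chartMulX hz.1 hz.2, (hmem v).1 hv z hz, mul_zero])
    (fun v hv => (hmem _).2 fun z hz => by
      rw [chartEval_chartMulY hz.1 hz.2, (hmem v).1 hv z hz, mul_zero])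
  have hz := mem_chartZeros_of_chartMul_eq_smul hX hY hk0
  have hk4 : k 4 ≠ 0 := fun h4 => hk0 (eq_zero_of_chartMul_eq_smul hX hY h4)
  -- Joint eigenvectors are determined by their last coordinate, which is `-2` for the Bezoutian; so
  -- `k` is a multiple of it, and its value at `(x, y)` is a nonzero multiple of `chartDet`.
  have hrel : k + (k 4 / 2) • chartBez p q r x y = 0 := by
    apply eq_zero_of_chartMul_eq_smul (p := p) (q := q) (r := r) (x := x) (y := y)
    · rw [map_add, map_smul, hX, chartMulX_chartBez hz.1 hz.2]; module
    · rw [map_add, map_smul, hY, chartMulY_chartBez hz.1 hz.2]; module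
    · simp [chartBez]
  have h1 := congrArg (chartEval x y) hrel
  rw [map_add, map_smul, (hmem k).1 hkW _ hz, chartEval_chartBez_self hz.1 hz.2, map_zero,
    zero_add, smul_eq_mul] at h1
  exact mul_ne_zero (div_ne_zero hk4 two_ne_zero) (hJ _ hz) h1

/-- Evaluating the Bezoutian vectors at the zeros gives a diagonal matrix with entries `chartDet`,
so they are independent in `ℂ⁵`. -/
theorem card_chartZeros_le (hJ : ∀ z ∈ chartZeros p q r, chartDet r z.1 z.2 ≠ 0) :
    (chartZeros_finite p q r).toFinset.card ≤ 5 := by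
  set S := (chartZeros_finite p q r).toFinset with hS
  have hmem : ∀ z ∈ S, z ∈ chartZeros p q r := fun z hz => by simpa [hS] using hz
  have hli : LinearIndependent ℂ (fun z : S => chartBez p q r z.1.1 z.1.2) := by
    rw [Fintype.linearIndependent_iff]
    intro c hc w
    have h1 := congrArg (chartEval w.1.1 w.1.2) hc
    rw [map_sum, map_zero, Finset.sum_eq_single w] at h1
    · rw [map_smul, smul_eq_mul, chartEval_chartBez_self (hmem _ w.2).1 (hmem _ w.2).2] at h1
      exact (mul_eq_zero.1 h1).resolve_right (hJ _ (hmem _ w.2))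
    · intro z _ hzw
      rw [map_smul, chartEval_chartBez_of_ne (hmem _ z.2) (hmem _ w.2)
        (fun h => hzw (Subtype.ext h)), smul_zero]
    · simp
  simpa using hli.fintype_card_le_finrank

/-- The Baum-Bott type relation for the zeros in the chart. -/
theorem sum_chartZeros (hJ : ∀ z ∈ chartZeros p q r, chartDet r z.1 z.2 ≠ 0) :
    ∑ z ∈ (chartZeros_finite p q r).toFinset,
      -(chartScale r z.1 z.2 * chartTrace r z.1 z.2) / chartDet r z.1 z.2 = 7 := by
  set S := (chartZeros_finite p q r).toFinset with hS
  have hmem : ∀ z, z ∈ S ↔ z ∈ chartZeros p q r := fun z => by simp [hS]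
  -- The reduction of minus scale times trace to the basis `1, x, y, xy, x²`.
  set g : Fin 5 → ℂ := ![(23 * p + 37 * q) / 2 + 2 * r ^ 2, (11 * q + 23 * r) / 2 - 111,
    (9 * r - 3 * p) / 2 - 69, 2 * r - 20, -14] with hg
  have hgev : ∀ z ∈ chartZeros p q r,
      chartEval z.1 z.2 g = -(chartScale r z.1 z.2 * chartTrace r z.1 z.2) := by
    rintro ⟨x, y⟩ ⟨hx, hy⟩
    unfold chartField at hx hy
    simp only at hx hy
    simp [chartEval_apply, hg, chartScale, chartTrace]
    linear_combination (23 / 2 - 3 / 2 * y) * hx + (11 / 2 * x + 37 / 2) * hy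
  -- Lagrange interpolation by the Bezoutians. Its last coordinate reads `-14 = -2 ∑`, which is
  -- where `7` comes from.
  have hzero : g - ∑ z ∈ S, (chartEval z.1 z.2 g / chartDet r z.1 z.2) •
      chartBez p q r z.1 z.2 = 0 := by
    refine eq_zero_of_chartEval_eq_zero hJ fun w hw => ?_
    rw [map_sub, map_sum, Finset.sum_eq_single_of_mem w ((hmem w).2 hw)]
    · rw [map_smul, smul_eq_mul, chartEval_chartBez_self hw.1 hw.2, div_mul_cancel₀ _ (hJ w hw),
        sub_self]
    · intro z hz hzw
      rw [map_smul, chartEval_chartBez_of_ne ((hmem z).1 hz) hw hzw, smul_zero]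
  have h4 := congrFun hzero 4
  simp only [Pi.sub_apply, Finset.sum_apply, Pi.smul_apply, smul_eq_mul, Pi.zero_apply] at h4
  have h5 : ∑ z ∈ S, chartEval z.1 z.2 g / chartDet r z.1 z.2 * chartBez p q r z.1 z.2 4 =
      ∑ z ∈ S, -(chartScale r z.1 z.2 * chartTrace r z.1 z.2) / chartDet r z.1 z.2 * (-2) :=
    Finset.sum_congr rfl fun z hz => by rw [hgev z ((hmem z).1 hz)]; simp [chartBez]
  rw [h5, ← Finset.sum_mul] at h4
  simp [hg] at h4
  linear_combination 1 / 2 * h4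

end Chart

/-! ### Polarization and exponents as eigenvalues. -/

section Exponents

open Polynomial

theorem MvPolynomial.pderiv_pderiv_comm {σ R : Type*} [CommRing R] (i j : σ)
    (f : MvPolynomial σ R) : pderiv i (pderiv j f) = pderiv j (pderiv i f) := by
  classical
  have h : ⁅(pderiv i : Derivation R (MvPolynomial σ R) (MvPolynomial σ R)),
      (pderiv j : Derivation R (MvPolynomial σ R) (MvPolynomial σ R))⁆ = 0 := by
    refine MvPolynomial.derivation_ext fun k => ?_
    rw [Derivation.commutator_apply]
    simp [pderiv_X, Pi.single_apply, apply_ite]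
  have := congrArg (fun D => D f) h
  simpa [Derivation.commutator_apply, sub_eq_zero] using this

namespace QuadraticVectorField

variable {n : ℕ} (X : QuadraticVectorField n)

/-- The second derivatives of the components of a quadratic field. -/
noncomputable def hessian (i j k : Fin n) : ℂ :=
  MvPolynomial.coeff 0 (MvPolynomial.pderiv k (MvPolynomial.pderiv j (X.P i)))

theorem hessian_comm (i j k : Fin n) : X.hessian i j k = X.hessian i k j := by
  rw [hessian, MvPolynomial.pderiv_pderiv_comm, hessian]

theorem jacobian_apply (a : Fin n → ℂ) (i j : Fin n) :
    X.jacobian a i j = ∑ k, X.hessian i j k * a k := by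
  have h1 : (MvPolynomial.pderiv j (X.P i)).IsHomogeneous 1 := (X.homogeneous i).pderiv
  have h2 := h1.sum_X_mul_pderiv
  rw [one_smul] at h2
  have h3 : ∀ k, MvPolynomial.pderiv k (MvPolynomial.pderiv j (X.P i)) =
      MvPolynomial.C (X.hessian i j k) := fun k =>
    MvPolynomial.totalDegree_eq_zero_iff_eq_C.1
      ((MvPolynomial.totalDegree_zero_iff_isHomogeneous _).2 h1.pderiv)
  rw [jacobian, Matrix.of_apply, ← h2, map_sum]
  simp [h3, mul_comm]

theorem two_mul_eval (z : Fin n → ℂ) (i : Fin n) :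
    2 * X.eval z i = (X.jacobian z).mulVec z i := by
  have h := congrArg (MvPolynomial.eval z) (X.homogeneous i).sum_X_mul_pderiv
  simp only [map_sum, map_mul, MvPolynomial.eval_X, nsmul_eq_mul, map_natCast] at h
  rw [eval, Matrix.mulVec, dotProduct]
  simp only [jacobian, Matrix.of_apply]
  push_cast at h
  rw [← h]
  exact Finset.sum_congr rfl fun j _ => mul_comm _ _

/-- The polarization of a quadratic field. -/
noncomputable def polarization : (Fin n → ℂ) →L[ℂ] (Fin n → ℂ) →L[ℂ] (Fin n → ℂ) :=
  LinearMap.toContinuousBilinearMap <| LinearMap.mk₂ ℂ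
    (fun a v => (2⁻¹ : ℂ) • (X.jacobian a).mulVec v)
    (fun a b v => by
      rw [← smul_add, ← Matrix.add_mulVec]
      congr 2
      ext i j
      simp [jacobian_apply, mul_add, Finset.sum_add_distrib])
    (fun c a v => by
      rw [smul_comm c, ← Matrix.smul_mulVec c]
      congr 2
      ext i j
      simp [jacobian_apply, Finset.mul_sum, mul_left_comm])
    (fun a v w => by rw [Matrix.mulVec_add, smul_add])
    (fun c a v => by rw [Matrix.mulVec_smul, smul_comm])

theorem polarization_apply (a v : Fin n → ℂ) :
    X.polarization a v = (2⁻¹ : ℂ) • (X.jacobian a).mulVec v := rfl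

theorem polarization_comm (a v : Fin n → ℂ) : X.polarization a v = X.polarization v a := by
  rw [polarization_apply, polarization_apply]
  congr 1
  ext i
  simp only [Matrix.mulVec, dotProduct, jacobian_apply, Finset.sum_mul]
  rw [Finset.sum_comm]
  refine Finset.sum_congr rfl fun k _ => Finset.sum_congr rfl fun j _ => ?_
  rw [X.hessian_comm]
  ring

theorem polarization_self (z : Fin n → ℂ) : X.polarization z z = X.eval z := by
  ext i
  rw [polarization_apply, Pi.smul_apply, ← two_mul_eval, smul_eq_mul, inv_mul_cancel_left₀]
  exact two_ne_zero

theorem toLin'_one_sub_jacobian (a : Fin n → ℂ) :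
    Matrix.toLin' (1 - X.jacobian a) = (kowalevski X.polarization a).toLinearMap := by
  ext1 v
  ext1
  simp [kowalevski_apply, polarization_apply]

theorem charpoly_kowalevski (a : Fin n → ℂ) :
    (kowalevski X.polarization a).toLinearMap.charpoly = (1 - X.jacobian a).charpoly := by
  rw [← toLin'_one_sub_jacobian, Matrix.charpoly_toLin']

theorem kowalevski_self {a : Fin n → ℂ} (ha : X.eval a = a) :
    kowalevski X.polarization a a = -a := by
  rw [kowalevski_apply, polarization_self, ha]
  module

/-- The exponents are the eigenvalues of the Kowalevski matrix, apart from one eigenvalue `-1`. -/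
theorem charpoly_kowalevski_eq {a : Fin n → ℂ} (ha : X.eval a = a) (ha0 : a ≠ 0) :
    (kowalevski X.polarization a).toLinearMap.charpoly =
      (Polynomial.X + C 1) * ((X.exponentsAt a).map fun t => Polynomial.X - C t).prod ∧
    (X.exponentsAt a).card = n - 1 := by
  have hroot : ((1 - X.jacobian a).charpoly).IsRoot (-1) := by
    rw [← charpoly_kowalevski, ← Module.End.hasEigenvalue_iff_isRoot_charpoly]
    refine Module.End.hasEigenvalue_of_hasEigenvector (x := a) ⟨?_, ha0⟩
    rw [Module.End.mem_eigenspace_iff]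
    simpa using X.kowalevski_self ha
  have hX : (Polynomial.X + C 1 : ℂ[X]) = Polynomial.X - C (-1) := by simp
  have hmonic : (Polynomial.X - C (-1) : ℂ[X]).Monic := monic_X_sub_C _
  have hmul := mul_divByMonic_eq_iff_isRoot.2 hroot
  set q := (1 - X.jacobian a).charpoly /ₘ (Polynomial.X - C (-1)) with hq
  have hexp : X.exponentsAt a = q.roots := by rw [exponentsAt, hX]
  have hqm : q.Monic := by
    have h1 := Matrix.charpoly_monic (1 - X.jacobian a)
    rw [← hmul] at h1
    exact hmonic.of_mul_monic_left h1
  have hsplit := IsAlgClosed.splits q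
  refine ⟨?_, ?_⟩
  · rw [charpoly_kowalevski, hexp, hX, ← hsplit.eq_prod_roots_of_monic hqm, hmul]
  · rw [hexp, splits_iff_card_roots.1 hsplit, hq, natDegree_divByMonic _ hmonic,
      Matrix.charpoly_natDegree_eq_dim, natDegree_X_sub_C, Fintype.card_fin]

end QuadraticVectorField

theorem Matrix.trace_and_det_of_charpoly_eq {M : Matrix (Fin 3) (Fin 3) ℂ} {s t : ℂ}
    (h : M.charpoly = (X + C 1) * ((X - C s) * (X - C t))) :
    M.trace = s + t - 1 ∧ M.det = -(s * t) := by
  have hroots : M.charpoly.roots = {-1, s, t} := by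
    have h1 : M.charpoly = (({-1, s, t} : Multiset ℂ).map fun a => X - C a).prod := by
      rw [h]; simp
    rw [h1, roots_multiset_prod_X_sub_C]
  refine ⟨?_, ?_⟩
  · rw [Matrix.trace_eq_sum_roots_charpoly, hroots]
    simp
    ring
  · rw [Matrix.det_eq_prod_roots_charpoly, hroots]
    simp

/-- Among pairs of nonzero integers, only `(1, 1)` and `(1, 2)` have a sum of inverses exceeding
`4/3`. -/
theorem inv_add_inv_le_or {a b : ℤ} (ha : a ≠ 0) (hb : b ≠ 0) :
    (a : ℝ)⁻¹ + (b : ℝ)⁻¹ ≤ 4 / 3 ∨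
      (a = 1 ∧ b = 1) ∨ (a = 1 ∧ b = 2) ∨ (a = 2 ∧ b = 1) := by
  have le_inv : ∀ {c : ℤ} {k : ℕ}, 0 < k → (k : ℤ) ≤ c → (c : ℝ)⁻¹ ≤ (k : ℝ)⁻¹ := by
    intro c k hk hc
    have : (k : ℝ) ≤ c := by exact_mod_cast hc
    gcongr
  have le_one : ∀ {c : ℤ}, c ≠ 0 → (c : ℝ)⁻¹ ≤ 1 := by
    intro c hc
    rcases lt_or_gt_of_ne hc with h | h
    · exact (inv_nonpos.2 (by exact_mod_cast h.le)).trans zero_le_one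
    · simpa using le_inv (c := c) (k := 1) one_pos (by exact_mod_cast h)
  have nonpos : ∀ {c : ℤ}, c < 0 → (c : ℝ)⁻¹ ≤ 0 := fun h => inv_nonpos.2 (by exact_mod_cast h.le)
  have h1a := le_one ha
  have h1b := le_one hb
  by_cases ha0 : a < 0
  · left; linarith [nonpos ha0]
  by_cases hb0 : b < 0
  · left; linarith [nonpos hb0]
  by_cases ha3 : 3 ≤ a
  · left; have := le_inv (c := a) (k := 3) (by norm_num) ha3; norm_num at this; linarith
  by_cases hb3 : 3 ≤ b
  · left; have := le_inv (c := b) (k := 3) (by norm_num) hb3; norm_num at this; linarith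
  have ha' : a = 1 ∨ a = 2 := by omega
  have hb' : b = 1 ∨ b = 2 := by omega
  rcases ha' with rfl | rfl <;> rcases hb' with rfl | rfl <;> norm_num

/-! ### Normal form and exponents in the chart. -/

section NormalForm

variable {E : Type*} [NormedAddCommGroup E] [NormedSpace ℂ E] {B : E →L[ℂ] E →L[ℂ] E}
  {e₁ e₂ u : E} {p q r : ℂ}

/-- The normal form of a quadratic field with two radial orbits of exponents `-1, -2`. -/
structure IsNormalForm (B : E →L[ℂ] E →L[ℂ] E) (e₁ e₂ u : E) (p q r : ℂ) : Prop where
  symm : ∀ v w, B v w = B w v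
  fst_fst : B e₁ e₁ = e₁
  snd_snd : B e₂ e₂ = e₂
  fst_snd : B e₁ e₂ = (2⁻¹ : ℂ) • u
  fst_thd : B e₁ u = (2⁻¹ : ℂ) • ((5 : ℂ) • u - (6 : ℂ) • e₂)
  snd_thd : B e₂ u = (2⁻¹ : ℂ) • ((5 : ℂ) • u - (6 : ℂ) • e₁)
  thd_thd : B u u = p • e₁ + q • e₂ + r • u

theorem IsNormalForm.apply_self (h : IsNormalForm B e₁ e₂ u p q r) (x y c : ℂ) :
    B (x • e₁ + y • e₂ + c • u) (x • e₁ + y • e₂ + c • u) =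
      (x ^ 2 - 6 * y * c + p * c ^ 2) • e₁ + (y ^ 2 - 6 * x * c + q * c ^ 2) • e₂ +
        (x * y + 5 * (x + y) * c + r * c ^ 2) • u := by
  simp only [map_add, map_smul, add_apply, smul_apply, h.symm e₂ e₁, h.symm u e₁, h.symm u e₂,
    h.fst_fst, h.snd_snd, h.fst_snd, h.fst_thd, h.snd_thd, h.thd_thd]
  module

theorem IsNormalForm.apply_self_of_mem (h : IsNormalForm B e₁ e₂ u p q r) {z : ℂ × ℂ}
    (hz : z ∈ chartZeros p q r) :
    B (z.1 • e₁ + z.2 • e₂ + u) (z.1 • e₁ + z.2 • e₂ + u) =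
      chartScale r z.1 z.2 • (z.1 • e₁ + z.2 • e₂ + u) := by
  obtain ⟨hx, hy⟩ := hz
  have h1 := h.apply_self z.1 z.2 1
  rw [one_smul] at h1
  rw [h1, show z.1 ^ 2 - 6 * z.2 * 1 + p * 1 ^ 2 = chartScale r z.1 z.2 * z.1 by
      rw [chartField] at hx; rw [chartScale]; linear_combination hx,
    show z.2 ^ 2 - 6 * z.1 * 1 + q * 1 ^ 2 = chartScale r z.1 z.2 * z.2 by
      rw [chartField] at hy; rw [chartScale]; linear_combination hy,
    show z.1 * z.2 + 5 * (z.1 + z.2) * 1 + r * 1 ^ 2 = chartScale r z.1 z.2 by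
      rw [chartScale]; ring]
  module

/-- A fixed point with nonzero last coordinate gives a zero in the chart. -/
theorem IsNormalForm.mem_chartZeros (h : IsNormalForm B e₁ e₂ u p q r)
    (hli : LinearIndependent ℂ ![u, e₁, e₂]) {x y c : ℂ} (hc : c ≠ 0)
    (hfix : B (x • e₁ + y • e₂ + c • u) (x • e₁ + y • e₂ + c • u) = x • e₁ + y • e₂ + c • u) :
    (x / c, y / c) ∈ chartZeros p q r ∧ chartScale r (x / c) (y / c) = c⁻¹ := by
  rw [h.apply_self] at hfix
  have h0 : (x * y + 5 * (x + y) * c + r * c ^ 2 - c) • u +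
      (x ^ 2 - 6 * y * c + p * c ^ 2 - x) • e₁ +
      (y ^ 2 - 6 * x * c + q * c ^ 2 - y) • e₂ = 0 := by
    rw [← sub_eq_zero] at hfix
    rw [← hfix]
    module
  have h1 := Fintype.linearIndependent_iff.1 hli
    ![x * y + 5 * (x + y) * c + r * c ^ 2 - c, x ^ 2 - 6 * y * c + p * c ^ 2 - x,
      y ^ 2 - 6 * x * c + q * c ^ 2 - y] (by simpa [Fin.sum_univ_three] using h0)
  have hu : x * y + 5 * (x + y) * c + r * c ^ 2 - c = 0 := h1 0
  have hx : x ^ 2 - 6 * y * c + p * c ^ 2 - x = 0 := h1 1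
  have hy : y ^ 2 - 6 * x * c + q * c ^ 2 - y = 0 := h1 2
  refine ⟨⟨?_, ?_⟩, ?_⟩
  · simp only [chartField]
    field_simp
    linear_combination c * hx - x * hu
  · simp only [chartField]
    field_simp
    linear_combination c * hy - y * hu
  · simp only [chartScale]
    field_simp
    linear_combination hu

theorem IsNormalForm.kowalevski_toMatrix (h : IsNormalForm B e₁ e₂ u p q r)
    (b : Module.Basis (Fin 3) ℂ E) (hb : ⇑b = ![u, e₁, e₂]) (x y c : ℂ) :
    LinearMap.toMatrix b b (kowalevski B (c • (x • e₁ + y • e₂ + u))).toLinearMap =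
      1 - c • !![5 * x + 5 * y + 2 * r, y + 5, x + 5; 2 * p - 6 * y, 2 * x, -6;
        2 * q - 6 * x, -6, 2 * y] := by
  rw [← LinearMap.toMatrix_toLin b b (1 - c • _)]
  congr 1
  refine b.ext fun j => ?_
  rw [Matrix.toLin_self]
  simp only [Fin.sum_univ_three, hb, ContinuousLinearMap.coe_coe, kowalevski_apply]
  fin_cases j <;>
  · simp [h.symm e₂ e₁, h.symm u e₁, h.symm u e₂,
      h.fst_fst, h.snd_snd, h.fst_snd, h.fst_thd, h.snd_thd, h.thd_thd]
    module

/-- The exponents of the radial orbits in the chart, in terms of the linear part of the foliation. -/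
theorem IsNormalForm.exponents [FiniteDimensional ℂ E] (h : IsNormalForm B e₁ e₂ u p q r)
    (b : Module.Basis (Fin 3) ℂ E) (hb : ⇑b = ![u, e₁, e₂]) {z : ℂ × ℂ}
    (hz : z ∈ chartZeros p q r) (hm : chartScale r z.1 z.2 ≠ 0) {s t : ℂ}
    (hst : LinearMap.charpoly (kowalevski B ((chartScale r z.1 z.2)⁻¹ •
      (z.1 • e₁ + z.2 • e₂ + u))).toLinearMap = (X + C 1) * ((X - C s) * (X - C t))) :
    chartScale r z.1 z.2 * (s + t) = -chartTrace r z.1 z.2 ∧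
      chartScale r z.1 z.2 ^ 2 * (s * t) = chartDet r z.1 z.2 := by
  rw [← LinearMap.charpoly_toMatrix _ b, h.kowalevski_toMatrix b hb] at hst
  obtain ⟨htr, hdet⟩ := Matrix.trace_and_det_of_charpoly_eq hst
  obtain ⟨x, y⟩ := z
  obtain ⟨hx, hy⟩ := hz
  simp only [chartField] at hx hy hm htr hdet ⊢
  set m := chartScale r x y with hmdef
  set N := !![5 * x + 5 * y + 2 * r, y + 5, x + 5; 2 * p - 6 * y, 2 * x, -6;
        2 * q - 6 * x, -6, 2 * y] with hN
  constructor
  · have htrN : N.trace = 7 * (x + y) + 2 * r := by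
      rw [hN, Matrix.trace_fin_three_of]; ring
    rw [Matrix.trace_sub, Matrix.trace_smul, Matrix.trace_one, htrN, smul_eq_mul,
      Fintype.card_fin] at htr
    have h1 : s + t = 4 - m⁻¹ * (7 * (x + y) + 2 * r) := by
      push_cast at htr
      linear_combination -htr
    rw [h1, mul_sub, mul_inv_cancel_left₀ hm, chartTrace, hmdef, chartScale]
    ring
  · have hfac : 1 - m⁻¹ • N = m⁻¹ • (m • (1 : Matrix (Fin 3) (Fin 3) ℂ) - N) := by
      rw [smul_sub, inv_smul_smul₀ hm]
    rw [hfac, Matrix.det_smul, Fintype.card_fin] at hdet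
    -- `N` is the matrix of `2 B v`, where `v = x e₁ + y e₂ + u` and `B v v = m v`. Thus `m - N` has
    -- eigenvalue `-m` along `v`, and the other factor is the determinant of the foliation, modulo
    -- the chart equations.
    have hdetN : (m • (1 : Matrix (Fin 3) (Fin 3) ℂ) - N).det = -(m * chartDet r x y) := by
      rw [Matrix.det_fin_three]
      simp [hN]
      rw [hmdef, chartScale, chartDet]
      linear_combination (-4 * x * y ^ 2 - 30 * x * y - 50 * x - 14 * y ^ 2 - 4 * y * r - 30 * y
        + 2 * q - 10 * r + 60) * hx + (2 * x ^ 2 - 10 * x * y - 30 * x - 26 * y - 2 * p - 10 * r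
        + 60) * hy
    rw [hdetN] at hdet
    have h2 : s * t = m⁻¹ ^ 3 * (m * chartDet r x y) := by linear_combination hdet
    rw [h2]
    field_simp

/-- In a semicomplete field, two fixed points whose Kowalevski matrices have minimal polynomial
`(X + 1) (X + 2)` generate, together with their product, a three-dimensional space. -/
theorem IsSemicomplete.linearIndependent_of_normalForm [CompleteSpace E]
    (hB : IsSemicomplete fun z => B z z) (hsymm : ∀ v w, B v w = B w v)
    (h₁ : B e₁ e₁ = e₁) (h₂ : B e₂ e₂ = e₂) (h₁₂ : B e₁ e₂ = (2⁻¹ : ℂ) • u)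
    (h₁u : B e₁ u = (2⁻¹ : ℂ) • ((5 : ℂ) • u - (6 : ℂ) • e₂))
    (h₂u : B e₂ u = (2⁻¹ : ℂ) • ((5 : ℂ) • u - (6 : ℂ) • e₁))
    (hli : LinearIndependent ℂ ![e₁, e₂]) : LinearIndependent ℂ ![u, e₁, e₂] := by
  refine linearIndependent_finCons.2 ⟨hli, fun hmem => ?_⟩
  rw [Matrix.range_cons, Matrix.range_cons, Matrix.range_empty, Set.union_empty,
    Set.singleton_union, Submodule.mem_span_pair] at hmem
  obtain ⟨α, β, rfl⟩ := hmem
  rw [LinearIndependent.pair_iff] at hli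
  simp only [map_add, map_smul, h₁, h₂, h₁₂, hsymm e₂ e₁] at h₁u h₂u
  obtain ⟨a1, a2⟩ := hli (α * (β - 3)) (β ^ 2 - 5 * β + 6) (by
    rw [← sub_eq_zero] at h₁u
    have := congrArg (fun v => (2 : ℂ) • v) h₁u
    simp only [smul_zero] at this
    rw [← this]
    module)
  obtain ⟨b1, b2⟩ := hli (α ^ 2 - 5 * α + 6) (β * (α - 3)) (by
    rw [← sub_eq_zero] at h₂u
    have := congrArg (fun v => (2 : ℂ) • v) h₂u
    simp only [smul_zero] at this
    rw [← this]
    module)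
  have hα0 : α ≠ 0 := by rintro rfl; norm_num at b1
  have hβ0 : β ≠ 0 := by rintro rfl; norm_num at a2
  have hβ : β = 3 := sub_eq_zero.1 ((mul_eq_zero.1 a1).resolve_left hα0)
  have hα : α = 3 := sub_eq_zero.1 ((mul_eq_zero.1 b2).resolve_left hβ0)
  subst hα hβ
  -- The dependent case leaves only `u = 3 e₁ + 3 e₂`. Then `(e₁ + e₂) / 4` is fixed and `e₁ - e₂`
  -- is an eigenvector of its Kowalevski matrix with non-integer eigenvalue `1/2`.
  have hfix : B ((4⁻¹ : ℂ) • (e₁ + e₂)) ((4⁻¹ : ℂ) • (e₁ + e₂)) = (4⁻¹ : ℂ) • (e₁ + e₂) := by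
    simp only [map_add, map_smul, add_apply, smul_apply, h₁, h₂, h₁₂, hsymm e₂ e₁]
    module
  have hne : e₁ - e₂ ≠ 0 := fun h => by
    have := (hli 1 (-1) (by rw [← h]; module)).1
    norm_num at this
  obtain ⟨n, hn⟩ := hB.exists_int_of_kowalevski_eq_smul hsymm hfix (μ := 2⁻¹) hne (by
    simp only [kowalevski_apply, map_sub, map_add, map_smul, add_apply, smul_apply, h₁, h₂, h₁₂,
      hsymm e₂ e₁]
    module)
  have h1 : (2 * n : ℂ) = 1 := by rw [← hn]; norm_num
  have h2 : 2 * n = 1 := by exact_mod_cast h1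
  omega

end NormalForm

/-! ### Applying the analytic constraints to the normal form. -/

namespace QuadraticVectorField

theorem isSemicomplete_polarization {n : ℕ} {X : QuadraticVectorField n}
    (h : IsSemicomplete X.eval) : IsSemicomplete fun z => X.polarization z z := by
  simpa only [polarization_self] using h

/-- Cayley–Hamilton gives `(K + 1)² (K + 2) = 0`, and the absence of Jordan blocks removes one
factor `K + 1`. For `2 B a = 1 - K` this becomes `T² - 5 T + 6 = 0`, the source of the coefficients
5 and 6. -/
theorem polarization_polarization_of_exponentsAt {X : QuadraticVectorField 3}
    (hX : IsSemicomplete X.eval) {a : Fin 3 → ℂ} (ha : X.eval a = a) (ha0 : a ≠ 0)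
    (hexp : X.exponentsAt a = {-1, -2}) (v : Fin 3 → ℂ) :
    X.polarization a ((2 : ℂ) • X.polarization a v) =
      (2⁻¹ : ℂ) • ((5 : ℂ) • (2 : ℂ) • X.polarization a v - (6 : ℂ) • v) := by
  have hfix : X.polarization a a = a := by rw [polarization_self, ha]
  have hchar := (X.charpoly_kowalevski_eq ha ha0).1
  have hCH := LinearMap.aeval_self_charpoly (kowalevski X.polarization a).toLinearMap
  rw [hchar, hexp] at hCH
  set K := kowalevski X.polarization a with hK
  have h1 := congrArg (fun f => f v) hCH
  simp at h1
  have h2 := (isSemicomplete_polarization hX).eq_zero_of_kowalevski_eq_smul_add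
    X.polarization_comm hfix (μ := -1) (v := K v + (2 : ℂ) • v)
    (n := K (K v + (2 : ℂ) • v) + (K v + (2 : ℂ) • v)) (by module) (by
      rw [← hK]
      simp only [map_add, map_smul]
      linear_combination (norm := module) h1)
  simp only [hK, kowalevski_apply, map_add, map_sub, map_smul] at h2
  rw [map_smul]
  linear_combination (norm := module) (2⁻¹ : ℂ) • h2

theorem IsRadialOrbit.eq_span {n : ℕ} {X : QuadraticVectorField n}
    {ρ : Submodule ℂ (Fin n → ℂ)} (hρ : X.IsRadialOrbit ρ) {a : Fin n → ℂ} (ha : a ∈ ρ)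
    (ha0 : a ≠ 0) : ρ = Submodule.span ℂ {a} := by
  have := FiniteDimensional.of_finrank_eq_succ hρ.1
  refine (Submodule.eq_of_le_of_finrank_eq ((Submodule.span_singleton_le_iff_mem _ _).2 ha) ?_).symm
  rw [finrank_span_singleton ha0, hρ.1]

theorem isRadialOrbit_span {n : ℕ} {X : QuadraticVectorField n} {v : Fin n → ℂ} (hv : v ≠ 0)
    {m : ℂ} (h : X.polarization v v = m • v) : X.IsRadialOrbit (Submodule.span ℂ {v}) := by
  refine ⟨finrank_span_singleton hv, fun z hz => ?_⟩
  obtain ⟨c, rfl⟩ := Submodule.mem_span_singleton.1 hz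
  rw [← polarization_self, map_smul, map_smul, smul_apply, h]
  exact Submodule.smul_mem _ _ (Submodule.smul_mem _ _ (Submodule.smul_mem _ _
    (Submodule.mem_span_singleton_self v)))

end QuadraticVectorField

namespace QuadraticVectorField

variable {X : QuadraticVectorField 3} {e₁ e₂ u : Fin 3 → ℂ} {p q r : ℂ}

/-- A semicomplete field with two radial orbits of exponents `-1, -2` has a normal form. -/
theorem exists_isNormalForm (hX : IsSemicomplete X.eval) {ρ₁ ρ₂ : Submodule ℂ (Fin 3 → ℂ)}
    (hne : ρ₁ ≠ ρ₂) (h₁ : X.HasExponents ρ₁ {-1, -2}) (h₂ : X.HasExponents ρ₂ {-1, -2}) :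
    ∃ e₁ ∈ ρ₁, ∃ e₂ ∈ ρ₂, ∃ (u : Fin 3 → ℂ) (p q r : ℂ),
      IsNormalForm X.polarization e₁ e₂ u p q r ∧ LinearIndependent ℂ ![u, e₁, e₂] := by
  obtain ⟨hρ₁, e₁, he₁ρ, he₁0, he₁, hexp₁⟩ := h₁
  obtain ⟨hρ₂, e₂, he₂ρ, he₂0, he₂, hexp₂⟩ := h₂
  have hli : LinearIndependent ℂ ![e₁, e₂] := by
    rw [LinearIndependent.pair_iff' he₁0]
    rintro c rfl
    have hc : c ≠ 0 := by rintro rfl; simp at he₂0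
    refine hne ?_
    rw [hρ₁.eq_span he₁ρ he₁0, hρ₂.eq_span he₂ρ he₂0,
      Submodule.span_singleton_smul_eq (isUnit_iff_ne_zero.2 hc)]
  have hsymm := X.polarization_comm
  have h11 : X.polarization e₁ e₁ = e₁ := by rw [polarization_self, he₁]
  have h22 : X.polarization e₂ e₂ = e₂ := by rw [polarization_self, he₂]
  have h12 : X.polarization e₁ e₂ = (2⁻¹ : ℂ) • (2 : ℂ) • X.polarization e₁ e₂ := by
    rw [inv_smul_smul₀ two_ne_zero]
  have h1u := polarization_polarization_of_exponentsAt hX he₁ he₁0 hexp₁ e₂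
  have h2u := polarization_polarization_of_exponentsAt hX he₂ he₂0 hexp₂ e₁
  rw [hsymm e₂ e₁] at h2u
  set u := (2 : ℂ) • X.polarization e₁ e₂
  have hli3 := (isSemicomplete_polarization hX).linearIndependent_of_normalForm hsymm h11 h22 h12
    h1u h2u hli
  let b := basisOfLinearIndependentOfCardEqFinrank hli3 (by simp)
  have hb : ⇑b = ![u, e₁, e₂] := coe_basisOfLinearIndependentOfCardEqFinrank _ _
  have huu := b.sum_repr (X.polarization u u)
  rw [Fin.sum_univ_three, hb] at huu
  refine ⟨e₁, he₁ρ, e₂, he₂ρ, u, b.repr (X.polarization u u) 1, b.repr (X.polarization u u) 2,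
    b.repr (X.polarization u u) 0, ⟨hsymm, h11, h22, h12, h1u, h2u, ?_⟩, hli3⟩
  nth_rw 1 [← huu]
  simp only [Matrix.cons_val_zero, Matrix.cons_val_one, Matrix.cons_val]
  abel

theorem ne_zero_of_linearIndependent (hli : LinearIndependent ℂ ![u, e₁, e₂]) (x y : ℂ) :
    x • e₁ + y • e₂ + u ≠ 0 := fun h => by
  have h1 := Fintype.linearIndependent_iff.1 hli ![1, x, y]
    (by rw [← h]; simp [Fin.sum_univ_three]; abel) 0
  simp at h1

theorem notMem_span_of_linearIndependent (hli : LinearIndependent ℂ ![u, e₁, e₂]) (x y : ℂ) :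
    e₁ ∉ Submodule.span ℂ {x • e₁ + y • e₂ + u} ∧
      e₂ ∉ Submodule.span ℂ {x • e₁ + y • e₂ + u} := by
  have key := Fintype.linearIndependent_iff.1 hli
  constructor
  · intro h
    obtain ⟨c, hc⟩ := Submodule.mem_span_singleton.1 h
    have h1 := key ![c, c * x - 1, c * y] (by
      rw [← sub_eq_zero] at hc
      rw [← hc]
      simp [Fin.sum_univ_three]
      module)
    have hc0 : c = 0 := h1 0
    have hc1 : c * x - 1 = 0 := h1 1
    rw [hc0] at hc1
    norm_num at hc1
  · intro h
    obtain ⟨c, hc⟩ := Submodule.mem_span_singleton.1 h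
    have h1 := key ![c, c * x, c * y - 1] (by
      rw [← sub_eq_zero] at hc
      rw [← hc]
      simp [Fin.sum_univ_three]
      module)
    have hc0 : c = 0 := h1 0
    have hc1 : c * y - 1 = 0 := h1 2
    rw [hc0] at hc1
    norm_num at hc1

/-- A zero scale would make the field vanish along a radial orbit. This is the point where
nondegeneracy enters. -/
theorem chartScale_ne_zero (hnondeg : X.IsNondegenerate)
    (hN : IsNormalForm X.polarization e₁ e₂ u p q r) (hli : LinearIndependent ℂ ![u, e₁, e₂])
    {z : ℂ × ℂ} (hz : z ∈ chartZeros p q r) : chartScale r z.1 z.2 ≠ 0 := by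
  intro h0
  have hv := ne_zero_of_linearIndependent hli z.1 z.2
  have hPv := hN.apply_self_of_mem hz
  refine hnondeg _ (isRadialOrbit_span hv hPv) _ (Submodule.mem_span_singleton_self _) hv ?_
  rw [← polarization_self, hPv, h0, zero_smul]

theorem eval_smul_of_mem_chartZeros (hN : IsNormalForm X.polarization e₁ e₂ u p q r)
    {z : ℂ × ℂ} (hz : z ∈ chartZeros p q r) (hm : chartScale r z.1 z.2 ≠ 0) :
    X.polarization ((chartScale r z.1 z.2)⁻¹ • (z.1 • e₁ + z.2 • e₂ + u))
      ((chartScale r z.1 z.2)⁻¹ • (z.1 • e₁ + z.2 • e₂ + u)) =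
      (chartScale r z.1 z.2)⁻¹ • (z.1 • e₁ + z.2 • e₂ + u) := by
  rw [map_smul, map_smul, smul_apply, hN.apply_self_of_mem hz, inv_smul_smul₀ hm]

/-- The radial orbits in the chart are isolated, hence none of their exponents vanishes. -/
theorem kowalevski_ne_zero (hX : IsSemicomplete X.eval)
    (hN : IsNormalForm X.polarization e₁ e₂ u p q r) (hli : LinearIndependent ℂ ![u, e₁, e₂])
    {z : ℂ × ℂ} (hz : z ∈ chartZeros p q r) (hm : chartScale r z.1 z.2 ≠ 0) {k : Fin 3 → ℂ}
    (hk : k ≠ 0) : kowalevski X.polarization ((chartScale r z.1 z.2)⁻¹ •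
      (z.1 • e₁ + z.2 • e₂ + u)) k ≠ 0 := by
  intro hker
  let b := basisOfLinearIndependentOfCardEqFinrank hli (by simp)
  have hb : ⇑b = ![u, e₁, e₂] := coe_basisOfLinearIndependentOfCardEqFinrank _ _
  set pt : ℂ × ℂ → Fin 3 → ℂ := fun w =>
    (chartScale r w.1 w.2)⁻¹ • (w.1 • e₁ + w.2 • e₂ + u) with hpt
  have hfin : (pt '' chartZeros p q r).Finite := (chartZeros_finite p q r).image _
  have hcont : Continuous (b.coord 0) := LinearMap.continuous_of_finiteDimensional _
  have hcoord : b.coord 0 (pt z) ≠ 0 := by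
    have h0 : b.repr u = Finsupp.single 0 1 := by rw [← b.repr_self 0, hb]; rfl
    have h1 : b.repr e₁ = Finsupp.single 1 1 := by rw [← b.repr_self 1, hb]; rfl
    have h2 : b.repr e₂ = Finsupp.single 2 1 := by rw [← b.repr_self 2, hb]; rfl
    simp [hpt, h0, h1, h2, hm]
  -- A neighbourhood inside the chart that avoids the finitely many other fixed points there; a
  -- nearby fixed point is then impossible.
  have hs : {w | b.coord 0 w ≠ 0} ∩ (pt '' chartZeros p q r \ {pt z})ᶜ ∈ nhds (pt z) :=
    Filter.inter_mem ((isOpen_ne.preimage hcont).mem_nhds hcoord)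
      ((hfin.subset Set.sdiff_subset).isClosed.isOpen_compl.mem_nhds (by simp))
  obtain ⟨w, ⟨hw0, hwS⟩, hwne, hwfix⟩ :=
    (isSemicomplete_polarization hX).exists_fixedPoint_near hN.symm
      (eval_smul_of_mem_chartZeros hN hz hm) hk hker hs
  refine hwS ⟨?_, hwne⟩
  have hw := b.sum_repr w
  rw [Fin.sum_univ_three, hb] at hw
  set x := b.repr w 1
  set y := b.repr w 2
  set c := b.repr w 0 with hc
  have hw' : w = x • e₁ + y • e₂ + c • u := by
    rw [← hw]
    simp only [Matrix.cons_val_zero, Matrix.cons_val_one, Matrix.cons_val]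
    abel
  have hc0 : c ≠ 0 := hw0
  rw [hw'] at hwfix
  obtain ⟨hmem, hscale⟩ := hN.mem_chartZeros hli hc0 hwfix
  refine ⟨_, hmem, ?_⟩
  simp only [hpt]
  rw [hscale, inv_inv, hw', smul_add, smul_add, smul_smul, smul_smul, mul_div_cancel₀ _ hc0,
    mul_div_cancel₀ _ hc0]

/-- The exponents of the radial orbits in the chart are nonzero integers. -/
theorem exists_int_exponents (hX : IsSemicomplete X.eval)
    (hN : IsNormalForm X.polarization e₁ e₂ u p q r) (hli : LinearIndependent ℂ ![u, e₁, e₂])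
    {z : ℂ × ℂ} (hz : z ∈ chartZeros p q r) (hm : chartScale r z.1 z.2 ≠ 0) :
    ∃ s t : ℤ, s ≠ 0 ∧ t ≠ 0 ∧
      X.HasExponents (Submodule.span ℂ {z.1 • e₁ + z.2 • e₂ + u}) {(s : ℂ), (t : ℂ)} ∧
      chartScale r z.1 z.2 * (s + t) = -chartTrace r z.1 z.2 ∧
      chartScale r z.1 z.2 ^ 2 * (s * t) = chartDet r z.1 z.2 := by
  have hv := ne_zero_of_linearIndependent hli z.1 z.2
  set v := z.1 • e₁ + z.2 • e₂ + u with hvdef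
  set m := chartScale r z.1 z.2 with hmdef
  have hfix : X.polarization (m⁻¹ • v) (m⁻¹ • v) = m⁻¹ • v := eval_smul_of_mem_chartZeros hN hz hm
  have hev : X.eval (m⁻¹ • v) = m⁻¹ • v := by rw [← polarization_self, hfix]
  have ha0 : m⁻¹ • v ≠ 0 := smul_ne_zero (inv_ne_zero hm) hv
  obtain ⟨hchar, hcard⟩ := X.charpoly_kowalevski_eq hev ha0
  obtain ⟨s, t, hst⟩ := Multiset.card_eq_two.1 hcard
  rw [hst] at hchar
  have hchar' : (kowalevski X.polarization (m⁻¹ • v)).toLinearMap.charpoly =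
      (Polynomial.X + C 1) * ((Polynomial.X - C s) * (Polynomial.X - C t)) := by
    rw [hchar]; simp
  have hint : ∀ l : ℂ, (kowalevski X.polarization (m⁻¹ • v)).toLinearMap.charpoly.IsRoot l →
      ∃ n : ℤ, n ≠ 0 ∧ l = n := by
    intro l hl
    rw [← Module.End.hasEigenvalue_iff_isRoot_charpoly] at hl
    obtain ⟨k, hk⟩ := hl.exists_hasEigenvector
    have hk' : kowalevski X.polarization (m⁻¹ • v) k = l • k := hk.apply_eq_smul
    obtain ⟨n, rfl⟩ := (isSemicomplete_polarization hX).exists_int_of_kowalevski_eq_smul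
      X.polarization_comm hfix hk.2 hk'
    refine ⟨n, ?_, rfl⟩
    rintro rfl
    rw [Int.cast_zero, zero_smul] at hk'
    exact kowalevski_ne_zero hX hN hli hz hm hk.2 hk'
  obtain ⟨s, hs0, rfl⟩ := hint s (by rw [hchar']; simp [IsRoot])
  obtain ⟨t, ht0, rfl⟩ := hint t (by rw [hchar']; simp [IsRoot])
  refine ⟨s, t, hs0, ht0, ⟨isRadialOrbit_span hv (hN.apply_self_of_mem hz), m⁻¹ • v,
    Submodule.smul_mem _ _ (Submodule.mem_span_singleton_self v), ha0, hev, hst⟩, ?_⟩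
  exact hN.exponents (basisOfLinearIndependentOfCardEqFinrank hli (by simp))
    (coe_basisOfLinearIndependentOfCardEqFinrank _ _) hz hm hchar'

end QuadraticVectorField

end Exponents

/-! ### Counting inverse exponents. -/

theorem lemma4p2 (X : QuadraticVectorField 3)
    (hnondeg : X.IsNondegenerate) (hsemi : IsSemicomplete X.eval)
    (ρ₁ ρ₂ : Submodule ℂ (Fin 3 → ℂ)) (hne : ρ₁ ≠ ρ₂)
    (h₁ : X.HasExponents ρ₁ {-1, -2}) (h₂ : X.HasExponents ρ₂ {-1, -2}) :
    ∃ ρ₃ : Submodule ℂ (Fin 3 → ℂ), ρ₃ ≠ ρ₁ ∧ ρ₃ ≠ ρ₂ ∧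
      (X.HasExponents ρ₃ {1, 2} ∨ X.HasExponents ρ₃ {1, 1}) := by
  obtain ⟨e₁, he₁, e₂, he₂, u, p, q, r, hN, hli⟩ :=
    QuadraticVectorField.exists_isNormalForm hsemi hne h₁ h₂
  have hm : ∀ z ∈ chartZeros p q r, chartScale r z.1 z.2 ≠ 0 := fun z hz =>
    QuadraticVectorField.chartScale_ne_zero hnondeg hN hli hz
  have hexp := fun z (hz : z ∈ chartZeros p q r) =>
    QuadraticVectorField.exists_int_exponents hsemi hN hli hz (hm z hz)
  have hJ : ∀ z ∈ chartZeros p q r, chartDet r z.1 z.2 ≠ 0 := by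
    intro z hz
    obtain ⟨s, t, hs, ht, -, -, hdet⟩ := hexp z hz
    rw [← hdet]
    exact mul_ne_zero (pow_ne_zero 2 (hm z hz))
      (mul_ne_zero (Int.cast_ne_zero.2 hs) (Int.cast_ne_zero.2 ht))
  by_contra hno
  have hle : ∀ z ∈ (chartZeros_finite p q r).toFinset,
      (-(chartScale r z.1 z.2 * chartTrace r z.1 z.2) / chartDet r z.1 z.2).re ≤ 4 / 3 := by
    intro z hz
    have hz' : z ∈ chartZeros p q r := by simpa using hz
    obtain ⟨s, t, hs, ht, hE, htr, hdet⟩ := hexp z hz'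
    -- With scale `m`, trace `-m (s + t)` and determinant `m² s t`, the residue term is `1/s + 1/t`,
    -- so five terms of at most `4/3` give `20/3 < 7`.
    have hval : -(chartScale r z.1 z.2 * chartTrace r z.1 z.2) / chartDet r z.1 z.2 =
        (((s : ℝ)⁻¹ + (t : ℝ)⁻¹ : ℝ) : ℂ) := by
      have hs' : (s : ℂ) ≠ 0 := Int.cast_ne_zero.2 hs
      have ht' : (t : ℂ) ≠ 0 := Int.cast_ne_zero.2 ht
      have hm' := hm z hz'
      rw [← mul_neg, ← htr, ← hdet]
      push_cast
      field_simp
      ring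
    rw [hval, Complex.ofReal_re]
    refine (inv_add_inv_le_or hs ht).resolve_right fun hcase => hno ?_
    obtain ⟨hn₁, hn₂⟩ :=
      QuadraticVectorField.notMem_span_of_linearIndependent hli z.1 z.2
    refine ⟨Submodule.span ℂ {z.1 • e₁ + z.2 • e₂ + u}, fun h => hn₁ (h ▸ he₁),
      fun h => hn₂ (h ▸ he₂), ?_⟩
    rcases hcase with ⟨rfl, rfl⟩ | ⟨rfl, rfl⟩ | ⟨rfl, rfl⟩
    · exact Or.inr (by simpa using hE)
    · exact Or.inl (by simpa using hE)
    · rw [Multiset.pair_comm] at hE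
      exact Or.inl (by simpa using hE)
  have hsum := congrArg Complex.re (sum_chartZeros hJ)
  rw [Complex.re_sum] at hsum
  have hbound := Finset.sum_le_card_nsmul _ _ _ hle
  have hcard : ((chartZeros_finite p q r).toFinset.card : ℝ) ≤ 5 := by
    exact_mod_cast card_chartZeros_le hJ
  rw [hsum, nsmul_eq_mul] at hbound
  norm_num at hbound
  linarith
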